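/- Let $n\ge 1$ and let $b:\mathbb R\to\mathbb R$ be a smooth, positive, non-constant function, periodic with period $T>0$. Put $$q(t)=\frac n2\Big(\frac n2+1\Big)\Big(\frac{\dot b(t)}{b(t)}\Big)^2-\frac n2\,\frac{\ddot b(t)}{b(t)} ,$$ and assume that Hill's equation $$y''(t)+\big(\lambda b^2(t)-q(t)\big)y(t)=0$$ has a nonempty open instability interval $\Lambda\subset(0,\infty)$, i.e. for every $\lambda\in\Lambda$ the trace of the monodromy matrix over one period $T$ has absolute value greater than $2$. Let $M$ be a smooth $m$-dimensional Riemannian manifold with a global chart, identified with an open set $\Omega\subset\mathbb R^m$ carrying a smooth metric tensor $(h_{ij})$, and let $\Gamma^i_{j,k}$ be its Christoffel symbols. Assume that $0\in\Omega$ and that the straight line $\{ta : t\in\mathbb R\}$, $0\ne a=(a_1,\dots,a_m)\in\mathbb R^m$, is a distinguished geodesic line: there is a function $f:\mathbb R\to\mathbb R$ such that $$\sum_{j,k=1}^m\Gamma^i_{j,k}(ta)\,a_ja_k=a_i f(t)\qquad(i=1,\dots,m)$$ for all $t\in\mathbb R$ with $ta\in\Omega$. Assume that the Nakanishi–Ohta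 condition is violated, that is, $$\int_0^\infty\exp\Big(\int_0^s f(r)\,dr\Big)ds<\infty\quad\text{and } ta\in\Omega\text{ for all }t>0,$$ or $$\int_{-\infty}^0\exp\Big(\int_0^s f(r)\,dr\Big)ds<\infty\quad\text{and } ta\in\Omega\text{ for all }t<0$$ (the requirements $ta\in\Omega$ are void if the whole line lies in $\Omega$). Then for every $s\in\mathbb R$ and every $\delta>0$ there are $u_0^i,u_1^i\in C_0^\infty(\mathbb R^n)$, $i=1,\dots,m$, with $(u_0^1(x),\dots,u_0^m(x))\in\Omega$ for all $x\in\mathbb R^n$ and $$\sum_{i=1}^m\Big(\|u_0^i\|_{H^{s+1}(\mathbb R^n)}+\|u_1^i\|_{H^{s}(\mathbb R^n)}\Big)\le\delta ,$$ such that there is no global solution $u=(u^1,\dots,u^m)\in C^2([0,\infty)\times\mathbb R^n)$, with values in $\Omega$, of the wave map system $$u^i_{tt}-n\frac{\dot b(t)}{b(t)}u^i_t-b^2(t)\Delta u^i+\sum_{j,k=1}^m\Gamma^i_{j,k}(u)\big(u^j_tu^k_t-b^2(t)\nabla u^j\cdot\nabla u^k\big)=0,\qquad i=1,\dots,m,$$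 with the Cauchy data $u^i(0,x)=u^i_0(x)$, $u^i_t(0,x)=u^i_1(x)$, $x\in\mathbb R^n$. -/

import Mathlib

open scoped ContDiff ENNReal FourierTransform

noncomputable section

namespace WaveMap

/-! ### The periodic ordinary differential equation -/

/-- The potential `q = (n/2)(n/2+1) (b'/b)^2 - (n/2) b''/b`. It is the one for which
`v = b^(n/2) y` solves `v'' - n (b'/b) v' + lam b^2 v = 0` iff `y'' + (lam b^2 - q) y = 0`;
equivalently `-q = (n/2)(1-n/2) ((1/b)')^2 b^2 - (n/2) (1/b)'' b`. -/
def potential (b : ℝ → ℝ) (n : ℕ) (t : ℝ) : ℝ :=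
  (n : ℝ) / 2 * ((n : ℝ) / 2 + 1) * (deriv b t / b t) ^ 2
    - (n : ℝ) / 2 * (deriv (deriv b) t / b t)

/-- `y` is a (global, classical) solution of `y'' + (lam b^2 - q) y = 0`. -/
structure IsHillSolution (b : ℝ → ℝ) (n : ℕ) (lam : ℝ) (y : ℝ → ℝ) : Prop where
  contDiff : ContDiff ℝ 2 y
  equation : ∀ t, deriv (deriv y) t + (lam * b t ^ 2 - potential b n t) * y t = 0

/-- The Hill equation with parameter `lam` and period `T` is unstable: the trace of its monodromy
matrix (the discriminant) has modulus larger than `2`; equivalently, its multipliers are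
`mu` and `1/mu` with `mu` real and `|mu| > 1`. Here `y₁`, `y₂` is the fundamental system
normalized at `0`. -/
def IsUnstable (b : ℝ → ℝ) (n : ℕ) (T lam : ℝ) : Prop :=
  ∃ y₁ y₂ : ℝ → ℝ,
    IsHillSolution b n lam y₁ ∧ y₁ 0 = 1 ∧ deriv y₁ 0 = 0 ∧
    IsHillSolution b n lam y₂ ∧ y₂ 0 = 0 ∧ deriv y₂ 0 = 1 ∧
    2 < |y₁ T + deriv y₂ T|

/-- There is a nonempty open instability interval contained in `(0, ∞)`. -/
def HasInstabilityInterval (b : ℝ → ℝ) (n : ℕ) (T : ℝ) : Prop :=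
  ∃ Lam : Set ℝ, IsOpen Lam ∧ Lam.Nonempty ∧ Lam.OrdConnected ∧ Lam ⊆ Set.Ioi 0 ∧
    ∀ lam ∈ Lam, IsUnstable b n T lam

/-! ### The target manifold in a global chart -/

/-- A smooth `m`-dimensional Riemannian manifold with a global chart, written in that chart:
an open set of `ℝ^m` with a smooth positive definite metric tensor. -/
structure RiemannianChart (m : ℕ) where
  domain : Set (Fin m → ℝ)
  isOpen_domain : IsOpen domain
  metric : (Fin m → ℝ) → Matrix (Fin m) (Fin m) ℝ
  smooth_metric : ∀ i j, ContDiffOn ℝ ∞ (fun p => metric p i j) domain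
  posDef_metric : ∀ p ∈ domain, (metric p).PosDef

/-- The partial derivative `∂ h_{kl} / ∂ u^j` of the metric tensor. -/
def RiemannianChart.dMetric {m : ℕ} (M : RiemannianChart m) (j k l : Fin m) (p : Fin m → ℝ) : ℝ :=
  fderiv ℝ (fun p' => M.metric p' k l) p (Pi.single j 1)

/-- The Christoffel symbols `Γ^i_{jk}`. -/
def RiemannianChart.christoffel {m : ℕ} (M : RiemannianChart m) (i j k : Fin m)
    (p : Fin m → ℝ) : ℝ :=
  1 / 2 * ∑ l, (M.metric p)⁻¹ i l * (M.dMetric j k l p + M.dMetric k j l p - M.dMetric l k j p)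

/-- The straight line `{t a}` through the origin of the chart is a distinguished geodesic line with
function `f`: at each of its points that lies in the chart,
`∑ Γ^i_{jk}(t a) a_j a_k = a_i f(t)`. -/
structure RiemannianChart.IsDistinguishedLine {m : ℕ} (M : RiemannianChart m) (a : Fin m → ℝ)
    (f : ℝ → ℝ) : Prop where
  ne_zero : a ≠ 0
  zero_mem : (0 : Fin m → ℝ) ∈ M.domain
  coherent : ∀ t : ℝ, t • a ∈ M.domain →
    ∀ i, ∑ j, ∑ k, M.christoffel i j k (t • a) * a j * a k = a i * f t

/-- The integral over `S` of `exp (∫₀ˢ f)` with respect to `s`, with value in `[0, ∞]`. -/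
def nakanishiOhtaIntegral (f : ℝ → ℝ) (S : Set ℝ) : ℝ≥0∞ :=
  ∫⁻ s in S, ENNReal.ofReal (Real.exp (∫ r in (0 : ℝ)..s, f r))

/-- The Nakanishi–Ohta condition fails along the line `{t a}`: one of the two integrals, over a
half-line that lies in the chart, is finite. If the whole line lies in the chart this is the
negation of `∫₀^∞ exp (∫₀ˢ f) ds = ∞ and ∫_{-∞}^0 exp (∫₀ˢ f) ds = ∞`. -/
def RiemannianChart.ViolatesNakanishiOhta {m : ℕ} (M : RiemannianChart m) (a : Fin m → ℝ)
    (f : ℝ → ℝ) : Prop :=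
  ((∀ t : ℝ, 0 < t → t • a ∈ M.domain) ∧ nakanishiOhtaIntegral f (Set.Ioi 0) < ⊤) ∨
  ((∀ t : ℝ, t < 0 → t • a ∈ M.domain) ∧ nakanishiOhtaIntegral f (Set.Iio 0) < ⊤)

/-! ### Data and solutions -/

/-- The `H^s(ℝ^n)` norm `( (2π)^{-n} ∫ (1+|ω|^2)^s |∫ e^{-i x ω} φ(x) dx|^2 dω )^{1/2}`, after the
substitution `ω = 2π ξ` that turns it into the normalization of `𝓕`. -/
def sobolevNorm {n : ℕ} (s : ℝ) (φ : EuclideanSpace ℝ (Fin n) → ℝ) : ℝ≥0∞ :=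
  (∫⁻ ξ : EuclideanSpace ℝ (Fin n), ENNReal.ofReal
    ((1 + (2 * Real.pi * ‖ξ‖) ^ 2) ^ s * ‖𝓕 (fun x => (φ x : ℂ)) ξ‖ ^ 2)) ^ (1 / 2 : ℝ)

/-- `u` is a solution, of class `C^2` on `[0, ∞) × ℝ^n` and with values in the chart, of the wave
map system with scale function `b`
`u^i_tt - n (b'/b) u^i_t - b^2 Δ u^i + ∑ Γ^i_{jk}(u) (u^j_t u^k_t - b^2 ∇u^j · ∇u^k) = 0`
with Cauchy data `u₀`, `u₁` at `t = 0`. -/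
structure IsGlobalSolution {n m : ℕ} (b : ℝ → ℝ) (M : RiemannianChart m)
    (u₀ u₁ : Fin m → EuclideanSpace ℝ (Fin n) → ℝ)
    (u : Fin m → ℝ → EuclideanSpace ℝ (Fin n) → ℝ) : Prop where
  contDiffOn : ∀ i, ContDiffOn ℝ 2
    (fun z : ℝ × EuclideanSpace ℝ (Fin n) => u i z.1 z.2) (Set.Ici 0 ×ˢ Set.univ)
  mem_domain : ∀ t, 0 ≤ t → ∀ x, (fun l => u l t x) ∈ M.domain
  equation : ∀ t, 0 < t → ∀ x i,
    deriv (deriv (fun τ => u i τ x)) t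
      - (n : ℝ) * (deriv b t / b t) * deriv (fun τ => u i τ x) t
      - b t ^ 2 * Laplacian.laplacian (u i t) x
      + ∑ j, ∑ k, M.christoffel i j k (fun l => u l t x) *
          (deriv (fun τ => u j τ x) t * deriv (fun τ => u k τ x) t
            - b t ^ 2 * inner ℝ (gradient (u j t) x) (gradient (u k t) x)) = 0
  initial_value : ∀ i x, u i 0 x = u₀ i x
  initial_velocity : ∀ i x, derivWithin (fun τ => u i τ x) (Set.Ici 0) 0 = u₁ i x

end WaveMap

end

namespace WaveMap

open Set MeasureTheory Filter Topology

/-! ### Calculus on the closed half space `[0, ∞) × ℝ^n` -/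

/-! Take data on the line, `u₀ = θ₀ a` and `u₁ = θ₁ a`, and suppose that a global solution exists.
The line is invariant under the nonlinearity, so the solution stays on it: `u = θ a`. This is a
uniqueness statement for wave inequalities on backward cones (`eq_zero_of_wave_inequality`,
`IsGlobalSolution.proj_eq_zero`), applied to the component of `u` transversal to the line. The same
argument with the identity as projection gives finite speed of propagation.

The scalar `θ` solves a wave equation with quadratic term `f(θ)(θ_t² - b²|∇θ|²)`. If `F'' = f F'`,
`F 0 = 0`, `F' 0 = 1` (`linearizer`), then `v = F(θ)` solves the linear equation `v_tt - n (b'/b)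
v_t - b² Δv = 0`. Violation of the Nakanishi–Ohta condition says that `F` is bounded above or below,
so `v` is bounded on one side for all time (`IsGlobalSolution.exists_linear`).

Such a `v` cannot grow fast. Its support lies in a ball whose radius is affine in `t`. Its mean `m`
satisfies `m'' = n (b'/b) m'`, so `m'` is a constant times `b^n` and `m` grows at most linearly. A
one-sided bound together with control of the mean bounds the `L¹` norm, hence every cosine mode,
polynomially (`cosMode_growth`).

On the other hand, the mode of frequency `κ`, divided by `b^(n/2)`, solves Hill's equation with `λ =
|κ|²`. For an unstable `λ` the multipliers are `μ` and `1/μ` with `|μ| > 1`, so polynomial growth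
confines the solution to the one-dimensional decaying Floquet space. Two linearly independent
initial vectors cannot both lie there (`IsUnstable.growth`). Pure velocity data and pure position
data `ε ψ a` produce independent vectors, whatever `ε > 0` is: if `ψ` is a bump so narrow that
`cos(κ·x) ≥ 0` on its support, the relevant mode is nonzero. So one of the two families never admits
global solutions, and `ε` can be taken as small as the Sobolev bound and the chart require. Which
family it is depends on the Hill equation; no local existence theory enters. -/

/-- The closed future half space `[0, ∞) × ℝ^n`. -/
def future (n : ℕ) : Set (ℝ × EuclideanSpace ℝ (Fin n)) := Ici 0 ×ˢ univ

/-- The directional derivative within the closed future half space. -/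
noncomputable def pd {n : ℕ} {F : Type*} [NormedAddCommGroup F] [NormedSpace ℝ F]
    (v : ℝ × EuclideanSpace ℝ (Fin n)) (W : ℝ × EuclideanSpace ℝ (Fin n) → F)
    (z : ℝ × EuclideanSpace ℝ (Fin n)) : F :=
  fderivWithin ℝ W (future n) z v

/-- The time direction. -/
def tDir (n : ℕ) : ℝ × EuclideanSpace ℝ (Fin n) := (1, 0)

/-- The spatial coordinate directions. -/
noncomputable def xDir {n : ℕ} (k : Fin n) : ℝ × EuclideanSpace ℝ (Fin n) :=
  (0, EuclideanSpace.single k 1)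

section

variable {n : ℕ} {F G : Type*} [NormedAddCommGroup F] [NormedSpace ℝ F]
  [NormedAddCommGroup G] [NormedSpace ℝ G]

theorem mem_future {z : ℝ × EuclideanSpace ℝ (Fin n)} : z ∈ future n ↔ 0 ≤ z.1 := by
  simp [future]

theorem uniqueDiffOn_future : UniqueDiffOn ℝ (future n) :=
  (uniqueDiffOn_Ici 0).prod uniqueDiffOn_univ

theorem convex_future : Convex ℝ (future n) := (convex_Ici 0).prod convex_univ

theorem mem_closure_interior_future {z : ℝ × EuclideanSpace ℝ (Fin n)} (hz : z ∈ future n) :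
    z ∈ closure (interior (future n)) := by
  rw [future, interior_prod_eq, interior_Ici, interior_univ, closure_prod_eq, closure_Ioi,
    closure_univ]
  exact hz

variable {W V : ℝ × EuclideanSpace ℝ (Fin n) → F}

theorem contDiffOn_pd (hW : ContDiffOn ℝ 2 W (future n)) (v : ℝ × EuclideanSpace ℝ (Fin n)) :
    ContDiffOn ℝ 1 (pd v W) (future n) := by
  have := hW.fderivWithin uniqueDiffOn_future (m := 1) (by norm_num)
  exact this.clm_apply contDiffOn_const

theorem continuousOn_pd (hW : ContDiffOn ℝ 1 W (future n)) (v : ℝ × EuclideanSpace ℝ (Fin n)) :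
    ContinuousOn (pd v W) (future n) := by
  have := hW.continuousOn_fderivWithin uniqueDiffOn_future (by norm_num)
  exact this.clm_apply continuousOn_const

theorem hasFDerivWithinAt_future (hW : ContDiffOn ℝ 1 W (future n))
    {z : ℝ × EuclideanSpace ℝ (Fin n)} (hz : z ∈ future n) :
    HasFDerivWithinAt W (fderivWithin ℝ W (future n) z) (future n) z :=
  ((hW.differentiableOn (by norm_num)) z hz).hasFDerivWithinAt

/-- Second derivatives commute up to the boundary `t = 0` because every point of the half space is a
limit of interior points. -/
theorem pd_comm (hW : ContDiffOn ℝ 2 W (future n)) (v w : ℝ × EuclideanSpace ℝ (Fin n))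
    {z : ℝ × EuclideanSpace ℝ (Fin n)} (hz : z ∈ future n) :
    pd v (pd w W) z = pd w (pd v W) z := by
  have hs := (hW z hz).isSymmSndFDerivWithinAt (by simp) uniqueDiffOn_future
    (mem_closure_interior_future hz) hz
  have hd := (hW.fderivWithin uniqueDiffOn_future (m := 1) (by norm_num)).differentiableOn
    (by norm_num) z hz
  have key : ∀ v w : ℝ × EuclideanSpace ℝ (Fin n), pd v (pd w W) z =
      fderivWithin ℝ (fderivWithin ℝ W (future n)) (future n) z v w := by
    intro v w
    have := (hd.hasFDerivWithinAt.clm_apply (hasFDerivWithinAt_const w z (future n))).fderivWithin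
      (uniqueDiffOn_future z hz)
    have e : pd w W = fun y => (fderivWithin ℝ W (future n) y) w := rfl
    rw [e, pd, this]
    simp
  rw [key, key]
  exact hs v w

theorem pd_clm (hW : ContDiffOn ℝ 1 W (future n)) (L : F →L[ℝ] G)
    (v : ℝ × EuclideanSpace ℝ (Fin n)) {z : ℝ × EuclideanSpace ℝ (Fin n)} (hz : z ∈ future n) :
    pd v (fun y => L (W y)) z = L (pd v W z) := by
  have := (L.hasFDerivAt.comp_hasFDerivWithinAt z (hasFDerivWithinAt_future hW hz)).fderivWithin
      (uniqueDiffOn_future z hz)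
  have e : (fun y => L (W y)) = L ∘ W := rfl
  rw [e, pd, this]
  rfl

theorem pd_congr {v : ℝ × EuclideanSpace ℝ (Fin n)} (h : ∀ y ∈ future n, W y = V y)
    {z : ℝ × EuclideanSpace ℝ (Fin n)} (hz : z ∈ future n) : pd v W z = pd v V z := by
  rw [pd, pd, fderivWithin_congr h (h z hz)]

theorem pd_eq_zero_of_eventually {v : ℝ × EuclideanSpace ℝ (Fin n)}
    {z : ℝ × EuclideanSpace ℝ (Fin n)} (hz : z ∈ future n)
    (h : ∀ᶠ y in 𝓝[future n] z, W y = 0) : pd v W z = 0 := by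
  have h' : W =ᶠ[𝓝[future n] z] (fun _ => (0 : F)) := h
  rw [pd, h'.fderivWithin_eq (h.self_of_nhdsWithin hz)]
  simp

theorem hasDerivWithinAt_time (hW : ContDiffOn ℝ 1 W (future n)) {t : ℝ} (ht : 0 ≤ t)
    (x : EuclideanSpace ℝ (Fin n)) :
    HasDerivWithinAt (fun τ => W (τ, x)) (pd (tDir n) W (t, x)) (Ici 0) t := by
  have h1 : HasDerivWithinAt (fun τ : ℝ => (τ, x)) (tDir n) (Ici 0) t :=
    (hasDerivWithinAt_id t _).prodMk (hasDerivWithinAt_const t _ x)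
  exact (hasFDerivWithinAt_future hW (z := (t, x)) (mem_future.2 ht)).comp_hasDerivWithinAt t h1
    (fun τ hτ => mem_future.2 hτ)

theorem hasDerivAt_time (hW : ContDiffOn ℝ 1 W (future n)) {t : ℝ} (ht : 0 < t)
    (x : EuclideanSpace ℝ (Fin n)) :
    HasDerivAt (fun τ => W (τ, x)) (pd (tDir n) W (t, x)) t :=
  (hasDerivWithinAt_time hW ht.le x).hasDerivAt (Ici_mem_nhds ht)

theorem hasFDerivAt_space (hW : ContDiffOn ℝ 1 W (future n)) {t : ℝ} (ht : 0 ≤ t)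
    (x : EuclideanSpace ℝ (Fin n)) :
    HasFDerivAt (fun y => W (t, y))
      ((fderivWithin ℝ W (future n) (t, x)).comp (ContinuousLinearMap.inr ℝ ℝ _)) x := by
  have h1 : HasFDerivWithinAt (fun y : EuclideanSpace ℝ (Fin n) => (t, y))
      (ContinuousLinearMap.inr ℝ ℝ (EuclideanSpace ℝ (Fin n))) univ x :=
    (hasFDerivAt_prodMk_right t x).hasFDerivWithinAt
  exact ((hasFDerivWithinAt_future hW (z := (t, x)) (mem_future.2 ht)).comp x h1
    (fun τ _ => mem_future.2 ht)).hasFDerivAt univ_mem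

theorem fderiv_space (hW : ContDiffOn ℝ 1 W (future n)) {t : ℝ} (ht : 0 ≤ t)
    (x e : EuclideanSpace ℝ (Fin n)) :
    fderiv ℝ (fun y => W (t, y)) x e = pd (0, e) W (t, x) := by
  rw [(hasFDerivAt_space hW ht x).fderiv]
  rfl

end

theorem continuous_slice {n : ℕ} {F : Type*} [TopologicalSpace F]
    {W : ℝ × EuclideanSpace ℝ (Fin n) → F} (hW : ContinuousOn W (future n)) {t : ℝ} (ht : 0 ≤ t) :
    Continuous (fun y => W (t, y)) :=
  hW.comp_continuous (by fun_prop) (fun y => mem_future.2 ht)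

/-! ### Products and sums of scalar functions -/

section

variable {n : ℕ} {W V : ℝ × EuclideanSpace ℝ (Fin n) → ℝ} {v z : ℝ × EuclideanSpace ℝ (Fin n)}

theorem pd_mul (hW : ContDiffOn ℝ 1 W (future n)) (hV : ContDiffOn ℝ 1 V (future n))
    (hz : z ∈ future n) :
    pd v (fun y => W y * V y) z = W z * pd v V z + pd v W z * V z := by
  have := ((hasFDerivWithinAt_future hW hz).mul (hasFDerivWithinAt_future hV hz)).fderivWithin
    (uniqueDiffOn_future z hz)
  have e : (fun y => W y * V y) = W * V := rfl
  rw [pd, e, this]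
  simp [pd, mul_comm]

theorem pd_add (hW : ContDiffOn ℝ 1 W (future n)) (hV : ContDiffOn ℝ 1 V (future n))
    (hz : z ∈ future n) :
    pd v (fun y => W y + V y) z = pd v W z + pd v V z := by
  have := ((hasFDerivWithinAt_future hW hz).add (hasFDerivWithinAt_future hV hz)).fderivWithin
    (uniqueDiffOn_future z hz)
  have e : (fun y => W y + V y) = W + V := rfl
  rw [pd, e, this]
  simp [pd]

theorem pd_sum {ι : Type*} (s : Finset ι) {A : ι → ℝ × EuclideanSpace ℝ (Fin n) → ℝ}
    (hA : ∀ i ∈ s, ContDiffOn ℝ 1 (A i) (future n)) (hz : z ∈ future n) :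
    pd v (fun y => ∑ i ∈ s, A i y) z = ∑ i ∈ s, pd v (A i) z := by
  have := (HasFDerivWithinAt.fun_sum (u := s)
    (fun i hi => hasFDerivWithinAt_future (hA i hi) hz)).fderivWithin (uniqueDiffOn_future z hz)
  rw [pd, this]
  simp [pd]

theorem pd_sq (hW : ContDiffOn ℝ 1 W (future n)) (hz : z ∈ future n) :
    pd v (fun y => W y ^ 2) z = 2 * W z * pd v W z := by
  have e : (fun y => W y ^ 2) = fun y => W y * W y := by ext y; ring
  rw [e, pd_mul hW hW hz]; ring

theorem pd_comp {g : ℝ → ℝ} {g' : ℝ} (hW : ContDiffOn ℝ 1 W (future n)) (hz : z ∈ future n)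
    (hg : HasDerivAt g g' (W z)) :
    pd v (fun y => g (W y)) z = g' * pd v W z := by
  have := (hg.comp_hasFDerivWithinAt z (hasFDerivWithinAt_future hW hz)).fderivWithin
    (uniqueDiffOn_future z hz)
  have e : (fun y => g (W y)) = g ∘ W := rfl
  rw [pd, e, this]
  simp [pd]

theorem pd_tDir_comp_fst {g : ℝ → ℝ} {g' : ℝ} (hz : z ∈ future n) (hg : HasDerivAt g g' z.1) :
    pd (tDir n) (fun y => g y.1) z = g' := by
  rw [pd_comp (W := fun y => y.1) contDiff_fst.contDiffOn hz hg]
  have : pd (tDir n) (fun y : ℝ × EuclideanSpace ℝ (Fin n) => y.1) z = 1 := by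
    rw [pd, (hasFDerivAt_fst.hasFDerivWithinAt).fderivWithin (uniqueDiffOn_future z hz)]
    rfl
  rw [this, mul_one]

/-! ### Integrals over time slices -/

theorem integrable_slice {g : ℝ × EuclideanSpace ℝ (Fin n) → ℝ} (hg : ContinuousOn g (future n))
    {t R : ℝ} (ht : 0 ≤ t) (hR : ∀ x, R < ‖x‖ → g (t, x) = 0) :
    Integrable (fun x => g (t, x)) := by
  refine (continuous_slice hg ht).integrable_of_hasCompactSupport ?_
  refine HasCompactSupport.intro (isCompact_closedBall 0 R) fun x hx => hR x ?_
  simpa using hx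

theorem continuousOn_integral_slice {g : ℝ × EuclideanSpace ℝ (Fin n) → ℝ}
    (hg : ContinuousOn g (future n)) {τ R : ℝ}
    (hR : ∀ t ∈ Icc 0 τ, ∀ x, R < ‖x‖ → g (t, x) = 0) :
    ContinuousOn (fun t => ∫ x, g (t, x)) (Icc 0 τ) := by
  refine continuousOn_integral_of_compact_support (f := fun t x => g (t, x))
    (isCompact_closedBall (0 : EuclideanSpace ℝ (Fin n)) R) ?_ ?_
  · exact hg.mono fun z hz => mem_future.2 hz.1.1
  · intro t x ht hx
    exact hR t ht x (by simpa using hx)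

/-- The time interval is open on the right so that the vanishing holds on a full relative
neighbourhood of `(t, x)`, and therefore passes to derivatives. -/
theorem pd_eq_zero_of_support {g : ℝ × EuclideanSpace ℝ (Fin n) → ℝ} {τ R : ℝ}
    (hR : ∀ t ∈ Ico 0 τ, ∀ x, R < ‖x‖ → g (t, x) = 0) {t : ℝ} (ht : t ∈ Ico 0 τ)
    {x : EuclideanSpace ℝ (Fin n)} (hx : R < ‖x‖) : pd v g (t, x) = 0 := by
  refine pd_eq_zero_of_eventually (mem_future.2 ht.1) ?_
  have h1 : ∀ᶠ y : ℝ × EuclideanSpace ℝ (Fin n) in 𝓝 (t, x), y.1 < τ ∧ R < ‖y.2‖ := by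
    refine IsOpen.mem_nhds ?_ (show t < τ ∧ R < ‖x‖ from ⟨ht.2, hx⟩)
    exact (isOpen_lt continuous_fst continuous_const).inter
      (isOpen_lt continuous_const continuous_snd.norm)
  filter_upwards [nhdsWithin_le_nhds h1, self_mem_nhdsWithin] with y hy hy'
  exact hR y.1 ⟨mem_future.1 hy', hy.1⟩ y.2 hy.2

theorem hasDerivAt_integral_slice {g : ℝ × EuclideanSpace ℝ (Fin n) → ℝ}
    (hg : ContDiffOn ℝ 1 g (future n)) {τ R : ℝ}
    (hR : ∀ t ∈ Ico 0 τ, ∀ x, R < ‖x‖ → g (t, x) = 0) {t : ℝ} (ht : t ∈ Ioo 0 τ) :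
    HasDerivAt (fun s => ∫ x, g (s, x)) (∫ x, pd (tDir n) g (t, x)) t := by
  have hsub : Ioo (t / 2) ((t + τ) / 2) ∈ 𝓝 t :=
    Ioo_mem_nhds (by linarith [ht.1]) (by linarith [ht.2])
  have hin : ∀ s ∈ Ioo (t / 2) ((t + τ) / 2), s ∈ Ioo 0 τ := fun s hs =>
    ⟨by linarith [hs.1, ht.1], by linarith [hs.2, ht.2]⟩
  have hK : IsCompact (Icc (t / 2) ((t + τ) / 2) ×ˢ
      Metric.closedBall (0 : EuclideanSpace ℝ (Fin n)) R) :=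
    isCompact_Icc.prod (isCompact_closedBall _ _)
  obtain ⟨C, hC⟩ := hK.exists_bound_of_continuousOn ((continuousOn_pd hg (tDir n)).mono
    (fun z hz => mem_future.2 (by linarith [hz.1.1, ht.1])))
  refine (hasDerivAt_integral_of_dominated_loc_of_deriv_le (F := fun s x => g (s, x))
    (F' := fun s x => pd (tDir n) g (s, x))
    (bound := (Metric.closedBall (0 : EuclideanSpace ℝ (Fin n)) R).indicator fun _ => C)
    hsub ?_ ?_ ?_ ?_ ?_ ?_).2
  · filter_upwards [hsub] with s hs
    exact (continuous_slice hg.continuousOn (hin s hs).1.le).aestronglyMeasurable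
  · exact integrable_slice hg.continuousOn ht.1.le (hR t ⟨ht.1.le, ht.2⟩)
  · exact (continuous_slice (continuousOn_pd hg _) ht.1.le).aestronglyMeasurable
  · refine Eventually.of_forall fun x s hs => ?_
    by_cases hx : x ∈ Metric.closedBall (0 : EuclideanSpace ℝ (Fin n)) R
    · rw [indicator_of_mem hx]
      exact hC (s, x) ⟨⟨hs.1.le, hs.2.le⟩, hx⟩
    · rw [indicator_of_notMem hx, pd_eq_zero_of_support hR ⟨(hin s hs).1.le, (hin s hs).2⟩
        (by simpa using hx)]
      simp
  · exact (integrable_indicator_iff measurableSet_closedBall).2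
      (integrableOn_const (isCompact_closedBall _ _).measure_lt_top.ne)
  · exact Eventually.of_forall fun x s hs => hasDerivAt_time hg (hin s hs).1 x

/-- Integration by parts against the constant function `1`; compact support removes the boundary
term. -/
theorem integral_pd_xDir_eq_zero {g : ℝ × EuclideanSpace ℝ (Fin n) → ℝ}
    (hg : ContDiffOn ℝ 1 g (future n)) {τ R : ℝ}
    (hR : ∀ t ∈ Ico 0 τ, ∀ x, R < ‖x‖ → g (t, x) = 0) {t : ℝ} (ht : t ∈ Ico 0 τ) (k : Fin n) :
    ∫ x, pd (xDir k) g (t, x) = 0 := by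
  have h := integral_mul_fderiv_eq_neg_fderiv_mul_of_integrable (μ := volume)
    (f := fun _ : EuclideanSpace ℝ (Fin n) => (1 : ℝ)) (g := fun x => g (t, x))
    (v := EuclideanSpace.single k 1) (by simp) ?_ ?_ (fun _ _ => by fun_prop)
    (fun x _ => (hasFDerivAt_space hg ht.1 x).differentiableAt)
  · simp only [one_mul, fderiv_space hg ht.1] at h
    simpa [xDir] using h
  · simp only [one_mul, fderiv_space hg ht.1]
    exact integrable_slice (continuousOn_pd hg _) ht.1 fun x hx => pd_eq_zero_of_support hR ht hx
  · simp only [one_mul]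
    exact integrable_slice hg.continuousOn ht.1 (hR t ht)

end

/-! ### Weighted energy estimates -/

/-- The energy density of a scalar function for the wave operator `∂_t^2 - b^2 Δ`. -/
noncomputable def energyDensity {n : ℕ} (b : ℝ → ℝ) (w : ℝ × EuclideanSpace ℝ (Fin n) → ℝ)
    (z : ℝ × EuclideanSpace ℝ (Fin n)) : ℝ :=
  1 / 2 * (pd (tDir n) w z ^ 2 + b z.1 ^ 2 * ∑ k, pd (xDir k) w z ^ 2 + w z ^ 2)

/-- The wave operator `∂_t^2 - b^2 Δ`. -/
noncomputable def waveOp {n : ℕ} (b : ℝ → ℝ) (w : ℝ × EuclideanSpace ℝ (Fin n) → ℝ)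
    (z : ℝ × EuclideanSpace ℝ (Fin n)) : ℝ :=
  pd (tDir n) (pd (tDir n) w) z - b z.1 ^ 2 * ∑ k, pd (xDir k) (pd (xDir k) w) z

section

variable {n : ℕ} {b : ℝ → ℝ} {w : ℝ × EuclideanSpace ℝ (Fin n) → ℝ}

theorem energyDensity_nonneg (z : ℝ × EuclideanSpace ℝ (Fin n)) : 0 ≤ energyDensity b w z := by
  have : 0 ≤ ∑ k, pd (xDir k) w z ^ 2 := Finset.sum_nonneg fun k _ => sq_nonneg _
  unfold energyDensity
  positivity

theorem contDiffOn_energyDensity (hb : ContDiff ℝ 1 b) (hw : ContDiffOn ℝ 2 w (future n)) :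
    ContDiffOn ℝ 1 (energyDensity b w) (future n) := by
  have h1 := contDiffOn_pd hw (tDir n)
  have h2 : ∀ k, ContDiffOn ℝ 1 (pd (xDir k) w) (future n) := fun k => contDiffOn_pd hw _
  have h3 : ContDiffOn ℝ 1 w (future n) := hw.of_le (by norm_num)
  have h4 : ContDiffOn ℝ 1 (fun z : ℝ × EuclideanSpace ℝ (Fin n) => b z.1) (future n) :=
    (hb.comp contDiff_fst).contDiffOn
  unfold energyDensity
  exact contDiffOn_const.mul (((h1.pow 2).add ((h4.pow 2).mul
    (ContDiffOn.sum fun k _ => (h2 k).pow 2))).add (h3.pow 2))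

theorem pd_tDir_energyDensity (hb : ContDiff ℝ 1 b) (hw : ContDiffOn ℝ 2 w (future n))
    {z : ℝ × EuclideanSpace ℝ (Fin n)} (hz : z ∈ future n) :
    pd (tDir n) (energyDensity b w) z =
      pd (tDir n) w z * pd (tDir n) (pd (tDir n) w) z
        + b z.1 * deriv b z.1 * ∑ k, pd (xDir k) w z ^ 2
        + b z.1 ^ 2 * ∑ k, pd (xDir k) w z * pd (tDir n) (pd (xDir k) w) z
        + w z * pd (tDir n) w z := by
  have h1 := contDiffOn_pd hw (tDir n)
  have h2 : ∀ k, ContDiffOn ℝ 1 (pd (xDir k) w) (future n) := fun k => contDiffOn_pd hw _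
  have h3 : ContDiffOn ℝ 1 w (future n) := hw.of_le (by norm_num)
  have h4 : ContDiffOn ℝ 1 (fun z : ℝ × EuclideanSpace ℝ (Fin n) => b z.1) (future n) :=
    (hb.comp contDiff_fst).contDiffOn
  have h5 : ContDiffOn ℝ 1 (fun z => ∑ k, pd (xDir k) w z ^ 2) (future n) :=
    ContDiffOn.sum fun k _ => (h2 k).pow 2
  have hbd : HasDerivAt b (deriv b z.1) z.1 :=
    ((hb.differentiable (by norm_num)) z.1).hasDerivAt
  unfold energyDensity
  rw [pd_mul contDiffOn_const (((h1.pow 2).add ((h4.pow 2).mul h5)).add (h3.pow 2)) hz,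
    pd_add ((h1.pow 2).add ((h4.pow 2).mul h5)) (h3.pow 2) hz,
    pd_add (h1.pow 2) ((h4.pow 2).mul h5) hz, pd_mul (h4.pow 2) h5 hz, pd_sq h1 hz, pd_sq h3 hz,
    pd_sq h4 hz, pd_tDir_comp_fst hz hbd, pd_sum _ (fun k _ => (h2 k).pow 2) hz]
  have : pd (tDir n) (fun _ : ℝ × EuclideanSpace ℝ (Fin n) => (1 / 2 : ℝ)) z = 0 := by
    simp [pd]
  rw [this, Finset.sum_congr rfl fun k _ => pd_sq (h2 k) hz]
  have : ∑ k, 2 * pd (xDir k) w z * pd (tDir n) (pd (xDir k) w) z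
      = 2 * ∑ k, pd (xDir k) w z * pd (tDir n) (pd (xDir k) w) z := by
    rw [Finset.mul_sum]; exact Finset.sum_congr rfl fun k _ => by ring
  rw [this]
  ring

/-- The flux through a spacelike weight has a sign. -/
theorem flux_nonpos {β B p χt o : ℝ} {q χ : Fin n → ℝ} (hB : 0 ≤ B) (hβ : B ≤ β)
    (hχt : χt ≤ 0) (hχ : β ^ 2 * ∑ k, χ k ^ 2 ≤ χt ^ 2) :
    χt * (1 / 2 * (p ^ 2 + B ^ 2 * ∑ k, q k ^ 2 + o ^ 2)) - B ^ 2 * p * ∑ k, χ k * q k ≤ 0 := by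
  have hcs := Finset.sum_mul_sq_le_sq_mul_sq Finset.univ χ q
  set Q := ∑ k, q k ^ 2
  set X := ∑ k, χ k ^ 2
  set Y := ∑ k, χ k * q k
  have hQ : 0 ≤ Q := Finset.sum_nonneg fun k _ => sq_nonneg _
  have hX : 0 ≤ X := Finset.sum_nonneg fun k _ => sq_nonneg _
  have hBX : B ^ 2 * X ≤ χt ^ 2 :=
    (mul_le_mul_of_nonneg_right (pow_le_pow_left₀ hB hβ 2) hX).trans hχ
  -- Square roots are avoided by comparing squares: `e1` is Cauchy–Schwarz with the spacelike
  -- condition, `e2` is AM–GM for `p²` and `B² Q`.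
  have h1 : (B ^ 2 * p * Y) ^ 2 ≤ (-χt * (1 / 2 * (p ^ 2 + B ^ 2 * Q))) ^ 2 := by
    have e1 : (B ^ 2 * p * Y) ^ 2 ≤ (B * p) ^ 2 * (χt ^ 2 * Q) := by
      have : B ^ 2 * Y ^ 2 ≤ χt ^ 2 * Q := by
        calc B ^ 2 * Y ^ 2 ≤ B ^ 2 * (X * Q) := by gcongr
          _ = B ^ 2 * X * Q := by ring
          _ ≤ χt ^ 2 * Q := by gcongr
      calc (B ^ 2 * p * Y) ^ 2 = (B * p) ^ 2 * (B ^ 2 * Y ^ 2) := by ring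
        _ ≤ _ := by gcongr
    have e2 : (B * p) ^ 2 * (χt ^ 2 * Q) ≤ (-χt * (1 / 2 * (p ^ 2 + B ^ 2 * Q))) ^ 2 := by
      have : 0 ≤ χt ^ 2 * (p ^ 2 - B ^ 2 * Q) ^ 2 := by positivity
      nlinarith [this]
    exact e1.trans e2
  have h2 := abs_le_of_sq_le_sq h1 (mul_nonneg (by linarith) (by positivity))
  have h3 : χt * o ^ 2 ≤ 0 := mul_nonpos_of_nonpos_of_nonneg hχt (sq_nonneg o)
  linarith [neg_abs_le (B ^ 2 * p * Y), h2]

theorem integrable_energySource (hb : ContDiff ℝ 1 b) (hw : ContDiffOn ℝ 2 w (future n))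
    {χ : ℝ × EuclideanSpace ℝ (Fin n) → ℝ} (hχ : ContDiffOn ℝ 1 χ (future n))
    {R t : ℝ} (ht : 0 ≤ t) (hR : ∀ x, R < ‖x‖ → χ (t, x) = 0) :
    Integrable fun x => χ (t, x) * (pd (tDir n) w (t, x) * waveOp b w (t, x)
      + b t * deriv b t * ∑ k, pd (xDir k) w (t, x) ^ 2 + w (t, x) * pd (tDir n) w (t, x)) := by
  have h1 := contDiffOn_pd hw (tDir n)
  have h2 : ∀ k, ContDiffOn ℝ 1 (pd (xDir k) w) (future n) := fun k => contDiffOn_pd hw _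
  have hb4 : ContinuousOn (fun z : ℝ × EuclideanSpace ℝ (Fin n) => b z.1) (future n) :=
    (hb.continuous.comp continuous_fst).continuousOn
  have hb5 : ContinuousOn (fun z : ℝ × EuclideanSpace ℝ (Fin n) => deriv b z.1) (future n) :=
    ((hb.continuous_deriv (by norm_num)).comp continuous_fst).continuousOn
  refine integrable_slice (g := fun z => χ z * (pd (tDir n) w z * waveOp b w z
    + b z.1 * deriv b z.1 * ∑ k, pd (xDir k) w z ^ 2 + w z * pd (tDir n) w z)) (R := R) ?_ ht
    fun x hx => by simp only [hR x hx, zero_mul]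
  refine hχ.continuousOn.mul (((h1.continuousOn.mul ?_).add
    ((hb4.mul hb5).mul ?_)).add (hw.continuousOn.mul h1.continuousOn))
  · exact (continuousOn_pd h1 _).sub ((hb4.pow 2).mul
      (continuousOn_finsetSum _ fun k _ => continuousOn_pd (h2 k) _))
  · exact continuousOn_finsetSum _ fun k _ => (h2 k).continuousOn.pow 2

/-- Energy inequality for a weight that decays along the characteristic cones. -/
theorem integral_pd_energy_le (hb : ContDiff ℝ 1 b) (hw : ContDiffOn ℝ 2 w (future n)) {β : ℝ}
    (hb0 : ∀ t, 0 ≤ b t) (hbβ : ∀ t, b t ≤ β)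
    {χ : ℝ × EuclideanSpace ℝ (Fin n) → ℝ} (hχ : ContDiffOn ℝ 1 χ (future n))
    (hχt : ∀ z ∈ future n, pd (tDir n) χ z ≤ 0)
    (hχx : ∀ z ∈ future n, β ^ 2 * ∑ k, pd (xDir k) χ z ^ 2 ≤ pd (tDir n) χ z ^ 2)
    {R : ℝ} (hR : ∀ t, 0 ≤ t → ∀ x, R < ‖x‖ → χ (t, x) = 0) {t : ℝ} (ht : 0 < t) :
    ∫ x, pd (tDir n) (fun z => χ z * energyDensity b w z) (t, x) ≤
      ∫ x, χ (t, x) * (pd (tDir n) w (t, x) * waveOp b w (t, x)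
        + b t * deriv b t * ∑ k, pd (xDir k) w (t, x) ^ 2 + w (t, x) * pd (tDir n) w (t, x)) := by
  have h1 := contDiffOn_pd hw (tDir n)
  have h2 : ∀ k, ContDiffOn ℝ 1 (pd (xDir k) w) (future n) := fun k => contDiffOn_pd hw _
  have h3 : ContDiffOn ℝ 1 w (future n) := hw.of_le (by norm_num)
  have he := contDiffOn_energyDensity hb hw
  have hRI : ∀ s ∈ Ico 0 (t + 1), ∀ x, R < ‖x‖ → χ (s, x) = 0 := fun s hs x hx => hR s hs.1 x hx
  have htI : t ∈ Ico 0 (t + 1) := ⟨ht.le, by linarith⟩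
  have hf : ∀ k, ContDiffOn ℝ 1 (fun z => χ z * (pd (tDir n) w z * pd (xDir k) w z)) (future n) :=
    fun k => hχ.mul (h1.mul (h2 k))
  have hfR : ∀ k, ∀ s ∈ Ico 0 (t + 1), ∀ x, R < ‖x‖ →
      (fun z => χ z * (pd (tDir n) w z * pd (xDir k) w z)) (s, x) = 0 := fun k s hs x hx => by
    simp only [hRI s hs x hx, zero_mul]
  have hdiv : ∀ k, ∫ x, pd (xDir k) (fun z => χ z * (pd (tDir n) w z * pd (xDir k) w z)) (t, x) = 0 :=
    fun k => integral_pd_xDir_eq_zero (hf k) (hfR k) htI k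
  have hfi : ∀ k, Integrable fun x =>
      pd (xDir k) (fun z => χ z * (pd (tDir n) w z * pd (xDir k) w z)) (t, x) := fun k =>
    integrable_slice (continuousOn_pd (hf k) _) ht.le fun x hx =>
      pd_eq_zero_of_support (hfR k) htI hx
  have hχe : ContDiffOn ℝ 1 (fun z => χ z * energyDensity b w z) (future n) := hχ.mul he
  have hei : Integrable fun x => pd (tDir n) (fun z => χ z * energyDensity b w z) (t, x) :=
    integrable_slice (continuousOn_pd hχe _) ht.le fun x hx =>
      pd_eq_zero_of_support (τ := t + 1) (R := R)
        (fun s hs x hx => by simp only [hRI s hs x hx, zero_mul]) htI hx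
  have hsum : Integrable fun x => ∑ k,
      pd (xDir k) (fun z => χ z * (pd (tDir n) w z * pd (xDir k) w z)) (t, x) :=
    integrable_finsetSum _ fun k _ => hfi k
  have hzero : ∫ x, b t ^ 2 * ∑ k,
      pd (xDir k) (fun z => χ z * (pd (tDir n) w z * pd (xDir k) w z)) (t, x) = 0 := by
    rw [integral_const_mul, integral_finsetSum _ fun k _ => hfi k]
    simp [hdiv]
  -- Subtracting `b²` times the spatial divergence of `χ w_t ∇w` does not change the integral. It
  -- trades the mixed derivatives for the wave operator and leaves exactly the flux expression of
  -- `flux_nonpos`.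
  have : ∫ x, pd (tDir n) (fun z => χ z * energyDensity b w z) (t, x) =
      ∫ x, (pd (tDir n) (fun z => χ z * energyDensity b w z) (t, x) - b t ^ 2 * ∑ k,
        pd (xDir k) (fun z => χ z * (pd (tDir n) w z * pd (xDir k) w z)) (t, x)) := by
    rw [integral_sub hei (hsum.const_mul _), hzero, sub_zero]
  rw [this]
  refine integral_mono (hei.sub (hsum.const_mul _))
    (integrable_energySource hb hw hχ ht.le (hR t ht.le)) fun x => ?_
  have hz : ((t, x) : ℝ × EuclideanSpace ℝ (Fin n)) ∈ future n := mem_future.2 ht.le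
  have key := flux_nonpos (p := pd (tDir n) w (t, x)) (o := w (t, x))
    (q := fun k => pd (xDir k) w (t, x)) (χ := fun k => pd (xDir k) χ (t, x)) (hb0 t) (hbβ t)
    (hχt _ hz) (hχx _ hz)
  have e1 : ∀ k, pd (xDir k) (fun z => χ z * (pd (tDir n) w z * pd (xDir k) w z)) (t, x) =
      χ (t, x) * (pd (tDir n) w (t, x) * pd (xDir k) (pd (xDir k) w) (t, x)) +
      χ (t, x) * (pd (xDir k) w (t, x) * pd (tDir n) (pd (xDir k) w) (t, x)) +
      pd (tDir n) w (t, x) * (pd (xDir k) χ (t, x) * pd (xDir k) w (t, x)) := fun k => by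
    rw [pd_mul hχ (h1.mul (h2 k)) hz, pd_mul h1 (h2 k) hz, pd_comm hw (xDir k) (tDir n) hz]
    ring
  simp only [Finset.sum_congr rfl fun k _ => e1 k, Finset.sum_add_distrib, ← Finset.mul_sum]
  rw [pd_mul hχ he hz, pd_tDir_energyDensity hb hw hz]
  simp only [waveOp, energyDensity] at key ⊢
  linarith

/-- Uniqueness on a cone for wave inequalities. -/
theorem eq_zero_of_wave_inequality {ι : Type*} [Fintype ι] (hb : ContDiff ℝ 1 b)
    (hb0 : ∀ t, 0 < b t) {β : ℝ} (hbβ : ∀ t, b t ≤ β)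
    {w : ι → ℝ × EuclideanSpace ℝ (Fin n) → ℝ} (hw : ∀ i, ContDiffOn ℝ 2 (w i) (future n))
    {t₁ C : ℝ} (ht₁ : 0 ≤ t₁) {x₀ : EuclideanSpace ℝ (Fin n)}
    (hC : ∀ t ∈ Ioc 0 t₁, ∀ x, ‖x - x₀‖ < β * t₁ + 2 →
      ∑ i, waveOp b (w i) (t, x) ^ 2 ≤ C * ∑ i, energyDensity b (w i) (t, x))
    (h0 : ∀ x, ‖x - x₀‖ < β * t₁ + 2 → ∀ i, w i (0, x) = 0)
    (h1 : ∀ x, ‖x - x₀‖ < β * t₁ + 2 → ∀ i, pd (tDir n) (w i) (0, x) = 0) (i : ι) :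
    w i (t₁, x₀) = 0 := by
  have hβ : 0 < β := (hb0 0).trans_le (hbβ 0)
  -- The `2` makes the phase below equal to `r - β t₁ - √1 = 1 > 0` at the vertex `(t₁, x₀)`, where
  -- the conclusion is read off. The root `√(1 + |x - x₀|²)` is a smooth substitute for `|x - x₀|`
  -- with gradient shorter than `1`, so the level sets are spacelike for speed `β`.
  set r := β * t₁ + 2 with hr
  -- the phase and the weight
  set φ : ℝ × EuclideanSpace ℝ (Fin n) → ℝ := fun z => r - β * z.1 - √(1 + ‖z.2 - x₀‖ ^ 2) with hφ
  -- A smooth nondecreasing function that vanishes exactly on `(-∞, 0]` turns the phase into a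
  -- weight supported where the phase is nonnegative.
  set χ : ℝ × EuclideanSpace ℝ (Fin n) → ℝ := fun z => expNegInvGlue (φ z) with hχdef
  have hsq : ∀ x : EuclideanSpace ℝ (Fin n), ‖x - x₀‖ < √(1 + ‖x - x₀‖ ^ 2) := fun x =>
    Real.lt_sqrt_of_sq_lt (by linarith)
  have hns : ContDiff ℝ 1 fun z : ℝ × EuclideanSpace ℝ (Fin n) => 1 + ‖z.2 - x₀‖ ^ 2 :=
    contDiff_const.add ((contDiff_snd.sub contDiff_const).norm_sq ℝ)
  have hφc : ContDiff ℝ 1 φ := (contDiff_const.sub (contDiff_const.mul contDiff_fst)).sub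
    (hns.sqrt fun z => by positivity)
  have hχc : ContDiffOn ℝ 1 χ (future n) := ((expNegInvGlue.contDiff (n := 1)).comp hφc).contDiffOn
  have hχnn : ∀ z, 0 ≤ χ z := fun z => expNegInvGlue.nonneg _
  have hχs : ∀ t, 0 ≤ t → ∀ x, χ (t, x) ≠ 0 → ‖x - x₀‖ < r := fun t ht x hne => by
    have : ¬ φ (t, x) ≤ 0 := fun h => hne (expNegInvGlue.zero_of_nonpos h)
    have h2 : 0 ≤ β * t := by positivity
    simp only [hφ, not_le] at this
    linarith [hsq x]
  have hR : ∀ t, 0 ≤ t → ∀ x, r + ‖x₀‖ < ‖x‖ → χ (t, x) = 0 := fun t ht x hx => by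
    by_contra hne
    have := hχs t ht x hne
    have := norm_sub_norm_le x x₀
    linarith
  have hgd : ∀ s : ℝ, HasDerivAt expNegInvGlue (deriv expNegInvGlue s) s := fun s =>
    (((expNegInvGlue.contDiff (n := 1)).differentiable (by norm_num)) s).hasDerivAt
  have hgm : ∀ s : ℝ, 0 ≤ deriv expNegInvGlue s := fun s => expNegInvGlue.monotone.deriv_nonneg
  have hφo : ContDiffOn ℝ 1 φ (future n) := hφc.contDiffOn
  have hφt : ∀ z ∈ future n, pd (tDir n) φ z = -β := fun z hz => by
    have h := (hasDerivWithinAt_time hφo (mem_future.1 hz) z.2)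
    have h' : HasDerivWithinAt (fun τ => φ (τ, z.2)) (-β) (Ici 0) z.1 := by
      have : HasDerivWithinAt (fun τ : ℝ => r - β * τ - √(1 + ‖z.2 - x₀‖ ^ 2)) (-(β * 1)) (Ici 0) z.1 :=
        (((hasDerivWithinAt_id z.1 _).const_mul β).const_sub r).sub_const _
      rw [mul_one] at this
      exact this
    exact (uniqueDiffOn_Ici 0 z.1 (mem_future.1 hz)).eq_deriv _ h h'
  have hφx : ∀ z ∈ future n, ∀ k, pd (xDir k) φ z = -((z.2 - x₀) k / √(1 + ‖z.2 - x₀‖ ^ 2)) := by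
    intro z hz k
    have h : HasFDerivAt (fun y : EuclideanSpace ℝ (Fin n) => 1 + ‖y - x₀‖ ^ 2)
        (2 • (innerSL ℝ (z.2 - x₀)).comp (ContinuousLinearMap.id ℝ _)) z.2 :=
      (((hasFDerivAt_id z.2).sub_const x₀).norm_sq).const_add 1
    have h2 := ((h.sqrt (by positivity)).const_sub (r - β * z.1)).fderiv
    have h3 := fderiv_space hφo (mem_future.1 hz) z.2 (EuclideanSpace.single k 1)
    change fderiv ℝ (fun y => r - β * z.1 - √(1 + ‖y - x₀‖ ^ 2)) z.2 _ = pd (xDir k) φ z at h3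
    rw [← h3, h2]
    simp only [neg_apply, smul_apply, smul_eq_mul,
      ContinuousLinearMap.comp_id, innerSL_apply_apply, EuclideanSpace.inner_single_right]
    simp
    ring
  have hχt' : ∀ z ∈ future n, pd (tDir n) χ z = -(β * deriv expNegInvGlue (φ z)) := fun z hz => by
    rw [hχdef, pd_comp hφo hz (hgd (φ z)), hφt z hz]; ring
  have hχt : ∀ z ∈ future n, pd (tDir n) χ z ≤ 0 := fun z hz => by
    rw [hχt' z hz]
    have := mul_nonneg hβ.le (hgm (φ z))
    linarith
  have hχx : ∀ z ∈ future n, β ^ 2 * ∑ k, pd (xDir k) χ z ^ 2 ≤ pd (tDir n) χ z ^ 2 := by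
    intro z hz
    have e : ∑ k, pd (xDir k) χ z ^ 2 =
        deriv expNegInvGlue (φ z) ^ 2 * (‖z.2 - x₀‖ ^ 2 / (1 + ‖z.2 - x₀‖ ^ 2)) := by
      rw [EuclideanSpace.real_norm_sq_eq, Finset.sum_div, Finset.mul_sum]
      refine Finset.sum_congr rfl fun k _ => ?_
      rw [hχdef, pd_comp hφo hz (hgd (φ z)), hφx z hz k, mul_pow, neg_sq, div_pow,
        Real.sq_sqrt (by positivity), EuclideanSpace.real_norm_sq_eq]
    rw [e, hχt' z hz]
    have : ‖z.2 - x₀‖ ^ 2 / (1 + ‖z.2 - x₀‖ ^ 2) ≤ 1 := by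
      rw [div_le_one (by positivity)]; linarith
    have h2 : 0 ≤ β ^ 2 * deriv expNegInvGlue (φ z) ^ 2 := by positivity
    nlinarith
  -- the energy
  have he := fun i => contDiffOn_energyDensity hb (hw i)
  set E : ℝ → ℝ := fun t => ∑ i, ∫ x, χ (t, x) * energyDensity b (w i) (t, x) with hE
  have hRe : ∀ i, ∀ t, 0 ≤ t → ∀ x, r + ‖x₀‖ < ‖x‖ →
      (fun z => χ z * energyDensity b (w i) z) (t, x) = 0 := fun i t ht x hx => by
    simp only [hR t ht x hx, zero_mul]
  have hEc : ContinuousOn E (Icc 0 t₁) := continuousOn_finsetSum _ fun i _ =>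
    continuousOn_integral_slice (g := fun z => χ z * energyDensity b (w i) z)
      (hχc.mul (he i)).continuousOn fun t ht x hx => hRe i t ht.1 x hx
  obtain ⟨B₁, hB₁⟩ := (isCompact_Icc (a := (0 : ℝ)) (b := t₁)).exists_bound_of_continuousOn
    (f := fun t => deriv b t / b t) ((hb.continuous_deriv (by norm_num)).continuousOn.div
      hb.continuous.continuousOn fun t _ => (hb0 t).ne')
  -- Young's inequality on `w_t □w` gives `C / 2` after summation; `b b' ≤ B₁ b²` gives `2 B₁`; the
  -- remaining `w_t²` and `w w_t` are absorbed by `2` times the density.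
  set K := C / 2 + 2 * B₁ + 2
  have hderiv : ∀ t ∈ Ioo 0 t₁, ∃ E', HasDerivAt E E' t ∧ E' ≤ K * E t := by
    intro t ht
    refine ⟨_, HasDerivAt.fun_sum fun i _ => hasDerivAt_integral_slice
      (g := fun z => χ z * energyDensity b (w i) z) (τ := t + 1) (hχc.mul (he i))
      (fun s hs x hx => hRe i s hs.1 x hx) ⟨ht.1, by linarith⟩, ?_⟩
    refine (Finset.sum_le_sum fun i _ => integral_pd_energy_le hb (hw i) (fun s => (hb0 s).le) hbβ
      hχc hχt hχx hR ht.1).trans ?_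
    have hint1 : ∀ i, Integrable fun x => χ (t, x) * energyDensity b (w i) (t, x) := fun i =>
      integrable_slice (g := fun z => χ z * energyDensity b (w i) z)
        (hχc.mul (he i)).continuousOn ht.1.le fun x hx => hRe i t ht.1.le x hx
    have hint2 : ∀ i, Integrable fun x => χ (t, x) * (pd (tDir n) (w i) (t, x) *
        waveOp b (w i) (t, x) + b t * deriv b t * ∑ k, pd (xDir k) (w i) (t, x) ^ 2
        + w i (t, x) * pd (tDir n) (w i) (t, x)) := fun i =>
      integrable_energySource hb (hw i) hχc ht.1.le (hR t ht.1.le)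
    rw [hE]
    simp only
    rw [← integral_finsetSum _ fun i _ => hint2 i, ← integral_finsetSum _ fun i _ => hint1 i,
      ← integral_const_mul]
    refine integral_mono (integrable_finsetSum _ fun i _ => hint2 i)
      ((integrable_finsetSum _ fun i _ => hint1 i).const_mul _) fun x => ?_
    simp only [← Finset.mul_sum]
    by_cases hx : χ (t, x) = 0
    · simp [hx]
    have hCx := hC t ⟨ht.1, ht.2.le⟩ x (hχs t ht.1.le x hx)
    rw [mul_left_comm]
    refine mul_le_mul_of_nonneg_left ?_ (hχnn _)
    have hbd : b t * deriv b t ≤ B₁ * b t ^ 2 := by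
      have h := (abs_le.1 (hB₁ t ⟨ht.1.le, ht.2.le⟩)).2
      rw [div_le_iff₀ (hb0 t)] at h
      nlinarith [hb0 t]
    have hpt : ∀ i, pd (tDir n) (w i) (t, x) * waveOp b (w i) (t, x) +
        b t * deriv b t * ∑ k, pd (xDir k) (w i) (t, x) ^ 2
        + w i (t, x) * pd (tDir n) (w i) (t, x) ≤
        1 / 2 * waveOp b (w i) (t, x) ^ 2 + (2 * B₁ + 2) * energyDensity b (w i) (t, x) := by
      intro i
      have hB0 : 0 ≤ B₁ := (norm_nonneg _).trans (hB₁ t ⟨ht.1.le, ht.2.le⟩)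
      have hQ : 0 ≤ ∑ k, pd (xDir k) (w i) (t, x) ^ 2 := Finset.sum_nonneg fun k _ => sq_nonneg _
      have e1 := mul_le_mul_of_nonneg_right hbd hQ
      have e2 : 0 ≤ b t ^ 2 * ∑ k, pd (xDir k) (w i) (t, x) ^ 2 := by positivity
      have e3 : 0 ≤ B₁ * pd (tDir n) (w i) (t, x) ^ 2 := by positivity
      have e4 : 0 ≤ B₁ * w i (t, x) ^ 2 := by positivity
      simp only [energyDensity]
      nlinarith [sq_nonneg (pd (tDir n) (w i) (t, x) - waveOp b (w i) (t, x)),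
        sq_nonneg (w i (t, x) - pd (tDir n) (w i) (t, x)), sq_nonneg (w i (t, x)),
        sq_nonneg (pd (tDir n) (w i) (t, x))]
    refine (Finset.sum_le_sum fun i _ => hpt i).trans ?_
    rw [Finset.sum_add_distrib, ← Finset.mul_sum, ← Finset.mul_sum]
    simp only [K]
    linarith
  have hE0 : E 0 = 0 := by
    refine Finset.sum_eq_zero fun i _ => ?_
    refine integral_eq_zero_of_ae (Eventually.of_forall fun x => ?_)
    by_cases hx : χ (0, x) = 0
    · simp [hx]
    have hx' := hχs 0 le_rfl x hx
    have hk : ∀ k, pd (xDir k) (w i) (0, x) = 0 := fun k => by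
      have h3 := fderiv_space ((hw i).of_le (by norm_num)) le_rfl x (EuclideanSpace.single k 1)
      have : (fun y => w i (0, y)) =ᶠ[𝓝 x] fun _ => (0 : ℝ) := by
        have : {y : EuclideanSpace ℝ (Fin n) | ‖y - x₀‖ < r} ∈ 𝓝 x :=
          (isOpen_lt (by fun_prop) continuous_const).mem_nhds hx'
        filter_upwards [this] with y hy using h0 y hy i
      rw [this.fderiv_eq] at h3
      simpa [xDir] using h3.symm
    simp [energyDensity, h0 x hx' i, h1 x hx' i, hk]
  have hEnn : ∀ t, 0 ≤ E t := fun t => Finset.sum_nonneg fun i _ =>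
    integral_nonneg fun x => mul_nonneg (hχnn _) (energyDensity_nonneg _)
  -- Grönwall with an integrating factor. The derivative exists only inside the interval; continuity
  -- of `E` carries the estimate to the endpoints.
  have hanti : AntitoneOn (fun t => Real.exp (-(K * t)) * E t) (Icc 0 t₁) := by
    have hexp : ∀ t, HasDerivAt (fun t => Real.exp (-(K * t))) (Real.exp (-(K * t)) * -(K * 1)) t :=
      fun t => ((hasDerivAt_id t).const_mul K).neg.exp
    refine antitoneOn_of_deriv_nonpos (convex_Icc _ _) ?_ ?_ ?_
    · exact ContinuousOn.mul (by fun_prop) hEc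
    · rw [interior_Icc]
      intro t ht
      obtain ⟨E', h, -⟩ := hderiv t ht
      exact ((hexp t).mul h).differentiableAt.differentiableWithinAt
    · rw [interior_Icc]
      intro t ht
      obtain ⟨E', h, hle⟩ := hderiv t ht
      have h5 := ((hexp t).mul h).deriv
      have e : (fun t => Real.exp (-(K * t)) * E t) = (fun t => Real.exp (-(K * t))) * E := rfl
      rw [e, h5]
      nlinarith [Real.exp_pos (-(K * t))]
  have hEt : E t₁ = 0 := by
    have h := hanti ⟨le_rfl, ht₁⟩ ⟨ht₁, le_rfl⟩ ht₁
    simp only [hE0, mul_zero] at h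
    refine le_antisymm ?_ (hEnn _)
    by_contra hcon
    push Not at hcon
    linarith [mul_pos (Real.exp_pos (-(K * t₁))) hcon]
  -- A continuous nonnegative integrand with zero integral vanishes everywhere, in particular at the
  -- vertex. The zero order term `w²` in the energy density then gives `w = 0` itself.
  have hi : ∫ x, χ (t₁, x) * energyDensity b (w i) (t₁, x) = 0 :=
    (Finset.sum_eq_zero_iff_of_nonneg fun i _ => integral_nonneg fun x =>
      mul_nonneg (hχnn _) (energyDensity_nonneg _)).1 hEt i (Finset.mem_univ i)
  have hcont := continuous_slice (hχc.mul (he i)).continuousOn ht₁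
  rw [integral_eq_zero_iff_of_nonneg (fun x => mul_nonneg (hχnn _) (energyDensity_nonneg _))
    (integrable_slice (g := fun z => χ z * energyDensity b (w i) z)
        (hχc.mul (he i)).continuousOn ht₁ fun x hx => hRe i t₁ ht₁ x hx)] at hi
  have h6 := congrFun ((Continuous.ae_eq_iff_eq volume hcont continuous_zero).1 hi) x₀
  have hpos : 0 < χ (t₁, x₀) := by
    apply expNegInvGlue.pos_of_pos
    simp [hφ, hr]
  have h7 : energyDensity b (w i) (t₁, x₀) = 0 := by
    rcases mul_eq_zero.1 h6 with h | h
    · exact absurd h hpos.ne'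
    · exact h
  have hQ : 0 ≤ ∑ k, pd (xDir k) (w i) (t₁, x₀) ^ 2 := Finset.sum_nonneg fun k _ => sq_nonneg _
  have e2 : 0 ≤ b t₁ ^ 2 * ∑ k, pd (xDir k) (w i) (t₁, x₀) ^ 2 := by positivity
  simp only [energyDensity] at h7
  have : w i (t₁, x₀) ^ 2 = 0 := by
    nlinarith [sq_nonneg (w i (t₁, x₀)), sq_nonneg (pd (tDir n) (w i) (t₁, x₀))]
  exact pow_eq_zero_iff (two_ne_zero) |>.1 this

end

/-! ### Regularity of the Christoffel symbols -/

section

variable {m : ℕ}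

theorem contDiffAt_det {E : Type*} [NormedAddCommGroup E] [NormedSpace ℝ E] {k : WithTop ℕ∞}
    {A : E → Matrix (Fin m) (Fin m) ℝ} {p : E}
    (hA : ∀ i j, ContDiffAt ℝ k (fun q => A q i j) p) : ContDiffAt ℝ k (fun q => (A q).det) p := by
  simp only [Matrix.det_apply']
  exact ContDiffAt.sum fun σ _ => contDiffAt_const.mul (contDiffAt_prod fun i _ => hA _ _)

/-- Cramer's rule: the entries of the inverse are polynomials in the entries divided by the
determinant. -/
theorem contDiffAt_inv_apply {E : Type*} [NormedAddCommGroup E] [NormedSpace ℝ E]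
    {k : WithTop ℕ∞} {A : E → Matrix (Fin m) (Fin m) ℝ} {p : E}
    (hA : ∀ i j, ContDiffAt ℝ k (fun q => A q i j) p) (hp : (A p).det ≠ 0) (i j : Fin m) :
    ContDiffAt ℝ k (fun q => (A q)⁻¹ i j) p := by
  simp only [Matrix.inv_def, Matrix.smul_apply, smul_eq_mul, Ring.inverse_eq_inv',
    Matrix.adjugate_apply]
  refine ((contDiffAt_det hA).inv hp).mul (contDiffAt_det fun i' j' => ?_)
  by_cases h : i' = j
  · subst h
    simp only [Matrix.updateRow_self]
    exact contDiffAt_const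
  · simp only [Matrix.updateRow_ne h]
    exact hA _ _

/-- Class `C¹` is what the local Lipschitz estimate for `lowerOrder` needs. Positive definiteness
keeps the determinant away from zero. -/
theorem RiemannianChart.contDiffAt_christoffel (M : RiemannianChart m) {p : Fin m → ℝ}
    (hp : p ∈ M.domain) (i j k : Fin m) : ContDiffAt ℝ 1 (M.christoffel i j k) p := by
  have hm : ∀ i j, ContDiffAt ℝ ∞ (fun q => M.metric q i j) p := fun i j =>
    (M.smooth_metric i j).contDiffAt (M.isOpen_domain.mem_nhds hp)
  have hd : ∀ i j k, ContDiffAt ℝ 1 (M.dMetric i j k) p := fun i j k =>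
    ((hm j k).fderiv_right (m := 1) (by norm_cast)).clm_apply contDiffAt_const
  have hinv : ∀ i j, ContDiffAt ℝ 1 (fun q => (M.metric q)⁻¹ i j) p := fun i j =>
    contDiffAt_inv_apply (fun i j => (hm i j).of_le (by norm_cast)) (M.posDef_metric p hp).det_pos.ne' i j
  unfold RiemannianChart.christoffel
  exact contDiffAt_const.mul (ContDiffAt.sum fun l _ =>
    (hinv i l).mul (((hd _ _ _).add (hd _ _ _)).sub (hd _ _ _)))

end

/-! ### Translation of the differential operators -/

section

variable {n : ℕ} {W : ℝ × EuclideanSpace ℝ (Fin n) → ℝ}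

theorem deriv_time_eq (hW : ContDiffOn ℝ 1 W (future n)) {t : ℝ} (ht : 0 < t)
    (x : EuclideanSpace ℝ (Fin n)) : deriv (fun τ => W (τ, x)) t = pd (tDir n) W (t, x) :=
  (hasDerivAt_time hW ht x).deriv

theorem deriv_deriv_time_eq (hW : ContDiffOn ℝ 2 W (future n)) {t : ℝ} (ht : 0 < t)
    (x : EuclideanSpace ℝ (Fin n)) :
    deriv (deriv (fun τ => W (τ, x))) t = pd (tDir n) (pd (tDir n) W) (t, x) := by
  have : deriv (fun τ => W (τ, x)) =ᶠ[𝓝 t] fun τ => pd (tDir n) W (τ, x) := by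
    filter_upwards [Ioi_mem_nhds ht] with τ hτ
    exact deriv_time_eq (hW.of_le (by norm_num)) hτ x
  rw [this.deriv_eq, deriv_time_eq (contDiffOn_pd hW _) ht x]

theorem contDiff_slice {k : WithTop ℕ∞} (hW : ContDiffOn ℝ k W (future n)) {t : ℝ} (ht : 0 ≤ t) :
    ContDiff ℝ k (fun y => W (t, y)) := by
  rw [← contDiffOn_univ]
  exact hW.comp (contDiff_const.prodMk contDiff_id).contDiffOn fun y _ => mem_future.2 ht

theorem laplacian_slice_eq (hW : ContDiffOn ℝ 2 W (future n)) {t : ℝ} (ht : 0 ≤ t)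
    (x : EuclideanSpace ℝ (Fin n)) :
    Laplacian.laplacian (fun y => W (t, y)) x = ∑ k, pd (xDir k) (pd (xDir k) W) (t, x) := by
  rw [InnerProductSpace.laplacian_eq_iteratedFDeriv_orthonormalBasis _
    (EuclideanSpace.basisFun (Fin n) ℝ)]
  refine Finset.sum_congr rfl fun k _ => ?_
  have h2 := contDiff_slice hW ht
  have hd : DifferentiableAt ℝ (fderiv ℝ fun y => W (t, y)) x :=
    ((h2.fderiv_right (m := 1) (by norm_num)).differentiable (by norm_num)) x
  rw [iteratedFDeriv_two_apply]
  simp only [EuclideanSpace.basisFun_apply, Matrix.cons_val_zero, Matrix.cons_val_one]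
  have e1 : fderiv ℝ (fun y => fderiv ℝ (fun y => W (t, y)) y (EuclideanSpace.single k 1)) x
      (EuclideanSpace.single k 1) =
      fderiv ℝ (fderiv ℝ fun y => W (t, y)) x (EuclideanSpace.single k 1)
        (EuclideanSpace.single k 1) := by
    rw [fderiv_clm_apply hd (differentiableAt_const _)]
    simp
  rw [← e1]
  simp only [fderiv_space (hW.of_le (by norm_num)) ht]
  exact fderiv_space (contDiffOn_pd hW _) ht x _

theorem inner_gradient_slice_eq {V : ℝ × EuclideanSpace ℝ (Fin n) → ℝ}
    (hW : ContDiffOn ℝ 1 W (future n)) (hV : ContDiffOn ℝ 1 V (future n)) {t : ℝ} (ht : 0 ≤ t)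
    (x : EuclideanSpace ℝ (Fin n)) :
    inner ℝ (gradient (fun y => W (t, y)) x) (gradient (fun y => V (t, y)) x) =
      ∑ k, pd (xDir k) W (t, x) * pd (xDir k) V (t, x) := by
  rw [← OrthonormalBasis.sum_inner_mul_inner (EuclideanSpace.basisFun (Fin n) ℝ)]
  refine Finset.sum_congr rfl fun k _ => ?_
  rw [real_inner_comm (gradient (fun y => V (t, y)) x)]
  simp only [gradient, InnerProductSpace.toDual_symm_apply, EuclideanSpace.basisFun_apply]
  rw [fderiv_space hW ht, fderiv_space hV ht]
  rfl

end

/-! ### Confinement to linear subspaces -/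

/-- First order jets of maps from `ℝ × ℝ^n` to `ℝ^m`: value, time derivative, space derivatives. -/
abbrev Jet (n m : ℕ) : Type := (Fin m → ℝ) × (Fin m → ℝ) × (Fin n → Fin m → ℝ)

/-- The jet of a map, with derivatives taken within the closed future half space. -/
noncomputable def jet {n m : ℕ} (U : ℝ × EuclideanSpace ℝ (Fin n) → Fin m → ℝ)
    (z : ℝ × EuclideanSpace ℝ (Fin n)) : Jet n m :=
  (U z, pd (tDir n) U z, fun k => pd (xDir k) U z)

/-- The part of the wave map operator that depends on the first order jet only. -/
noncomputable def lowerOrder {n m : ℕ} (b : ℝ → ℝ) (M : RiemannianChart m) (q : ℝ × Jet n m) :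
    Fin m → ℝ := fun i =>
  ∑ j, ∑ k, M.christoffel i j k q.2.1 *
    (q.2.2.1 j * q.2.2.1 k - b q.1 ^ 2 * ∑ l, q.2.2.2 l j * q.2.2.2 l k)
  - (n : ℝ) * (deriv b q.1 / b q.1) * q.2.2.1 i

theorem contDiffAt_lowerOrder {n m : ℕ} {b : ℝ → ℝ} (hb : ContDiff ℝ 2 b) (hb0 : ∀ t, b t ≠ 0)
    (M : RiemannianChart m) {q : ℝ × Jet n m} (hq : q.2.1 ∈ M.domain) :
    ContDiffAt ℝ 1 (lowerOrder (n := n) b M) q := by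
  have hb1 : ContDiff ℝ 1 b := hb.of_le (by norm_num)
  have hb' : ContDiff ℝ 1 (deriv b) := by
    have h : ContDiff ℝ (1 + 1) b := by norm_num; exact hb
    exact (contDiff_succ_iff_deriv.1 h).2.2
  have hξ : ∀ j, ContDiff ℝ 1 fun q : ℝ × Jet n m => q.2.2.1 j := fun j => by fun_prop
  have hη : ∀ l j, ContDiff ℝ 1 fun q : ℝ × Jet n m => q.2.2.2 l j := fun l j => by
    have h : ContDiff ℝ 1 fun q : ℝ × Jet n m => q.2.2.2 := by fun_prop
    exact contDiff_pi.1 (contDiff_pi.1 h l) j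
  have hβ : ContDiff ℝ 1 fun q : ℝ × Jet n m => b q.1 := hb1.comp contDiff_fst
  have hβ' : ContDiff ℝ 1 fun q : ℝ × Jet n m => deriv b q.1 := hb'.comp contDiff_fst
  refine contDiffAt_pi.2 fun i => ContDiffAt.sub (ContDiffAt.sum fun j _ =>
    ContDiffAt.sum fun k _ => ContDiffAt.mul ?_ (ContDiff.contDiffAt ?_)) (ContDiff.contDiffAt ?_)
  · have h : ContDiffAt ℝ 1 (fun q : ℝ × Jet n m => q.2.1) q := by fun_prop
    exact ContDiffAt.comp (g := M.christoffel i j k) q (M.contDiffAt_christoffel hq i j k) h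
  · exact ((hξ j).mul (hξ k)).sub ((hβ.pow 2).mul
      (ContDiff.sum fun l _ => (hη l j).mul (hη l k)))
  · exact (contDiff_const.mul (hβ'.div hβ fun q => hb0 _)).mul (hξ i)

/-- A `C¹` function of `J` that vanishes at `J - D` is locally bounded by a multiple of `D`. -/
theorem eventually_norm_le_of_vanishing {Z X Y : Type*} [TopologicalSpace Z]
    [NormedAddCommGroup X] [NormedSpace ℝ X] [NormedAddCommGroup Y] [NormedSpace ℝ Y]
    {s : Set Z} {z₀ : Z} {τ : Z → ℝ} {J D : Z → X} {Ψ : ℝ × X → Y}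
    (hτ : ContinuousWithinAt τ s z₀) (hJ : ContinuousWithinAt J s z₀)
    (hD : ContinuousWithinAt D s z₀) (hΨ : ContDiffAt ℝ 1 Ψ (τ z₀, J z₀))
    (h0 : D z₀ = 0 → ∀ᶠ z in 𝓝[s] z₀, Ψ (τ z, J z - D z) = 0) :
    ∃ C : ℝ, 0 ≤ C ∧ ∀ᶠ z in 𝓝[s] z₀, ‖Ψ (τ z, J z)‖ ≤ C * ‖D z‖ := by
  have hp : Tendsto (fun z => (τ z, J z)) (𝓝[s] z₀) (𝓝 (τ z₀, J z₀)) := by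
    exact (hτ.prodMk hJ).tendsto
  -- If `D` vanishes at `z₀`, compare `Ψ` at `J` and at `J - D` by the local Lipschitz bound.
  -- Otherwise `‖D‖` is bounded below near `z₀`, and local boundedness of `Ψ` is enough.
  by_cases hz : D z₀ = 0
  · obtain ⟨L, N, hN, hL⟩ := hΨ.exists_lipschitzOnWith
    have hp2 : Tendsto (fun z => (τ z, J z - D z)) (𝓝[s] z₀) (𝓝 (τ z₀, J z₀)) := by
      have h : Tendsto (fun z => J z - D z) (𝓝[s] z₀) (𝓝 (J z₀ - D z₀)) := hJ.sub hD
      rw [hz, sub_zero] at h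
      exact hτ.tendsto.prodMk_nhds h
    refine ⟨L, L.2, ?_⟩
    filter_upwards [hp hN, hp2 hN, h0 hz] with z h1 h2 h3
    have h4 := hL.dist_le_mul _ h1 _ h2
    rw [h3, dist_zero_right] at h4
    refine h4.trans (mul_le_mul_of_nonneg_left ?_ L.2)
    rw [Prod.dist_eq]
    simp
  · have hb : ∀ᶠ z in 𝓝[s] z₀, ‖Ψ (τ z, J z)‖ < ‖Ψ (τ z₀, J z₀)‖ + 1 :=
      ((hΨ.continuousAt.tendsto.comp hp).norm).eventually_lt_const (by linarith)
    have hd : ∀ᶠ z in 𝓝[s] z₀, ‖D z₀‖ / 2 < ‖D z‖ :=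
      hD.norm.tendsto.eventually_const_lt (by linarith [norm_pos_iff.2 hz])
    have hpos : 0 < ‖D z₀‖ / 2 := by linarith [norm_pos_iff.2 hz]
    refine ⟨(‖Ψ (τ z₀, J z₀)‖ + 1) / (‖D z₀‖ / 2), by positivity, ?_⟩
    filter_upwards [hb, hd] with z h1 h2
    calc ‖Ψ (τ z, J z)‖ ≤ ‖Ψ (τ z₀, J z₀)‖ + 1 := h1.le
      _ = (‖Ψ (τ z₀, J z₀)‖ + 1) / (‖D z₀‖ / 2) * (‖D z₀‖ / 2) := by field_simp
      _ ≤ _ := by gcongr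

/-- Local constants add up over a finite cover; `D ≥ 0` makes enlarging the constant harmless. -/
theorem exists_bound_on_compact {Z : Type*} [TopologicalSpace Z] {s K : Set Z} (hK : IsCompact K)
    (hKs : K ⊆ s) {A D : Z → ℝ} (hD : ∀ z, 0 ≤ D z)
    (h : ∀ z₀ ∈ s, ∃ C : ℝ, 0 ≤ C ∧ ∀ᶠ z in 𝓝[s] z₀, A z ≤ C * D z) :
    ∃ C : ℝ, 0 ≤ C ∧ ∀ z ∈ K, A z ≤ C * D z := by
  refine hK.induction_on (p := fun N => ∃ C : ℝ, 0 ≤ C ∧ ∀ z ∈ N, A z ≤ C * D z) ?_ ?_ ?_ ?_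
  · exact ⟨0, le_rfl, by simp⟩
  · rintro N N' hN ⟨C, hC, h⟩
    exact ⟨C, hC, fun z hz => h z (hN hz)⟩
  · rintro N N' ⟨C, hC, h⟩ ⟨C', hC', h'⟩
    refine ⟨C + C', by positivity, fun z hz => ?_⟩
    have := mul_nonneg hC (hD z)
    have := mul_nonneg hC' (hD z)
    rcases hz with hz | hz
    · linarith [h z hz]
    · linarith [h' z hz]
  · intro z hz
    obtain ⟨C, hC, h⟩ := h z (hKs hz)
    exact ⟨{y | A y ≤ C * D y}, nhdsWithin_mono z hKs h, C, hC, fun _ h => h⟩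

section

variable {n m : ℕ} {b : ℝ → ℝ} {M : RiemannianChart m}
  {u₀ u₁ : Fin m → EuclideanSpace ℝ (Fin n) → ℝ} {u : Fin m → ℝ → EuclideanSpace ℝ (Fin n) → ℝ}

/-- A family of component functions as one vector valued function on space-time. -/
def toMap (u : Fin m → ℝ → EuclideanSpace ℝ (Fin n) → ℝ) (z : ℝ × EuclideanSpace ℝ (Fin n)) :
    Fin m → ℝ := fun l => u l z.1 z.2

theorem IsGlobalSolution.contDiffOn_toMap (h : IsGlobalSolution b M u₀ u₁ u) :
    ContDiffOn ℝ 2 (toMap u) (future n) :=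
  contDiffOn_pi.2 fun i => h.contDiffOn i

theorem pd_apply {U : ℝ × EuclideanSpace ℝ (Fin n) → Fin m → ℝ}
    (hU : ContDiffOn ℝ 1 U (future n)) (v : ℝ × EuclideanSpace ℝ (Fin n))
    {z : ℝ × EuclideanSpace ℝ (Fin n)} (hz : z ∈ future n) (i : Fin m) :
    pd v (fun y => U y i) z = pd v U z i :=
  pd_clm hU (ContinuousLinearMap.proj (R := ℝ) (φ := fun _ : Fin m => ℝ) i) v hz

/-- The wave operator of a linear image of a vector valued function. -/
theorem waveOp_clm {U : ℝ × EuclideanSpace ℝ (Fin n) → Fin m → ℝ}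
    (hU : ContDiffOn ℝ 2 U (future n)) (L : (Fin m → ℝ) →L[ℝ] ℝ)
    {z : ℝ × EuclideanSpace ℝ (Fin n)} (hz : z ∈ future n) :
    waveOp b (fun y => L (U y)) z = L (fun i => waveOp b (fun y => U y i) z) := by
  have hU1 : ContDiffOn ℝ 1 U (future n) := hU.of_le (by norm_num)
  have key : ∀ (G : Type) [NormedAddCommGroup G] [NormedSpace ℝ G] (L : (Fin m → ℝ) →L[ℝ] G)
      (v : ℝ × EuclideanSpace ℝ (Fin n)),
      pd v (pd v (fun y => L (U y))) z = L (pd v (pd v U) z) := fun G _ _ L v => by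
    rw [pd_congr (fun y hy => pd_clm hU1 L v hy) hz]
    exact pd_clm (contDiffOn_pd hU v) L v hz
  have key2 : ∀ i v, pd v (pd v (fun y => U y i)) z = pd v (pd v U) z i := fun i v =>
    key ℝ (ContinuousLinearMap.proj (R := ℝ) (φ := fun _ : Fin m => ℝ) i) v
  have e : (fun i => waveOp b (fun y => U y i) z) = pd (tDir n) (pd (tDir n) U) z
      - b z.1 ^ 2 • ∑ k, pd (xDir k) (pd (xDir k) U) z := by
    ext i
    simp [waveOp, key2]
  rw [e, map_sub, map_smul, map_sum]
  simp only [waveOp, key ℝ L, smul_eq_mul]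

/-- The system becomes a semilinear equation for `∂_t² - b² Δ`; the damping and the geometry are
both part of a function of the first order jet. -/
theorem IsGlobalSolution.waveOp_eq (h : IsGlobalSolution b M u₀ u₁ u)
    {t : ℝ} (ht : 0 < t) (x : EuclideanSpace ℝ (Fin n)) (i : Fin m) :
    waveOp b (fun y => toMap u y i) (t, x) =
      - lowerOrder (n := n) b M (t, jet (toMap u) (t, x)) i := by
  have hU := h.contDiffOn_toMap
  have hU1 : ContDiffOn ℝ 1 (toMap u) (future n) := hU.of_le (by norm_num)
  have hz : ((t, x) : ℝ × EuclideanSpace ℝ (Fin n)) ∈ future n := mem_future.2 ht.le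
  have hi : ∀ i, ContDiffOn ℝ 2 (fun y => toMap u y i) (future n) := fun i => h.contDiffOn i
  have hi1 : ∀ i, ContDiffOn ℝ 1 (fun y => toMap u y i) (future n) := fun i =>
    (hi i).of_le (by norm_num)
  have e1 : ∀ i, deriv (fun τ => u i τ x) t = pd (tDir n) (toMap u) (t, x) i := fun i =>
    (deriv_time_eq (hi1 i) ht x).trans (pd_apply hU1 _ hz i)
  have e2 : ∀ i, deriv (deriv (fun τ => u i τ x)) t =
      pd (tDir n) (pd (tDir n) (fun y => toMap u y i)) (t, x) := fun i =>
    deriv_deriv_time_eq (hi i) ht x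
  have e3 : ∀ i, Laplacian.laplacian (u i t) x =
      ∑ k, pd (xDir k) (pd (xDir k) (fun y => toMap u y i)) (t, x) := fun i =>
    laplacian_slice_eq (hi i) ht.le x
  have e4 : ∀ j k, inner ℝ (gradient (u j t) x) (gradient (u k t) x) =
      ∑ l, pd (xDir l) (toMap u) (t, x) j * pd (xDir l) (toMap u) (t, x) k := fun j k => by
    refine (inner_gradient_slice_eq (hi1 j) (hi1 k) ht.le x).trans ?_
    simp only [pd_apply hU1 _ hz]
  have := h.equation t ht x i
  simp only [e1, e2, e3, e4] at this
  simp only [waveOp, lowerOrder, jet]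
  have e5 : (fun l => u l t x) = toMap u (t, x) := rfl
  rw [e5] at this
  linarith

theorem continuousOn_jet {U : ℝ × EuclideanSpace ℝ (Fin n) → Fin m → ℝ}
    (hU : ContDiffOn ℝ 1 U (future n)) : ContinuousOn (jet U) (future n) :=
  hU.continuousOn.prodMk ((continuousOn_pd hU _).prodMk
    (continuousOn_pi.2 fun _ => continuousOn_pd hU _))

/-- The energy carries the factor `b²` on spatial derivatives, so the lower bound `c` costs `2 /
c²`; values and time derivatives cost `2`. -/
theorem norm_jet_sq_le {U : ℝ × EuclideanSpace ℝ (Fin n) → Fin m → ℝ}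
    (hU : ContDiffOn ℝ 1 U (future n)) {c : ℝ} (hc : 0 < c) {z : ℝ × EuclideanSpace ℝ (Fin n)}
    (hbc : c ≤ b z.1) (hz : z ∈ future n) :
    ‖jet U z‖ ^ 2 ≤ (2 + 2 / c ^ 2) * ∑ i, energyDensity b (fun y => U y i) z := by
  set E := ∑ i, energyDensity b (fun y => U y i) z
  have hle : ∀ i, energyDensity b (fun y => U y i) z ≤ E := fun i =>
    Finset.single_le_sum (f := fun i => energyDensity b (fun y => U y i) z)
      (fun i _ => energyDensity_nonneg z) (Finset.mem_univ i)
  have hE : 0 ≤ E := Finset.sum_nonneg fun i _ => energyDensity_nonneg z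
  have hC : 0 ≤ 2 / c ^ 2 * E := by positivity
  have hQ : ∀ i, 0 ≤ ∑ k, pd (xDir k) (fun y => U y i) z ^ 2 := fun i =>
    Finset.sum_nonneg fun k _ => sq_nonneg _
  have hbQ : ∀ i, 0 ≤ b z.1 ^ 2 * ∑ k, pd (xDir k) (fun y => U y i) z ^ 2 := fun i =>
    mul_nonneg (sq_nonneg _) (hQ i)
  have hs : ‖jet U z‖ ≤ √((2 + 2 / c ^ 2) * E) := by
    have h1 : ∀ i, |U z i| ≤ √((2 + 2 / c ^ 2) * E) := fun i => by
      refine Real.abs_le_sqrt ?_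
      have := hle i
      simp only [energyDensity] at this
      nlinarith [hbQ i, sq_nonneg (pd (tDir n) (fun y => U y i) z)]
    have h2 : ∀ i, |pd (tDir n) U z i| ≤ √((2 + 2 / c ^ 2) * E) := fun i => by
      refine Real.abs_le_sqrt ?_
      have := hle i
      simp only [energyDensity, pd_apply hU _ hz] at this
      have h := hbQ i
      simp only [pd_apply hU _ hz] at h
      nlinarith [sq_nonneg (U z i)]
    have h3 : ∀ k i, |pd (xDir k) U z i| ≤ √((2 + 2 / c ^ 2) * E) := fun k i => by
      refine Real.abs_le_sqrt ?_
      have h4 := hle i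
      simp only [energyDensity, pd_apply hU _ hz] at h4
      have h5 : pd (xDir k) U z i ^ 2 ≤ ∑ k, pd (xDir k) U z i ^ 2 :=
        Finset.single_le_sum (f := fun k => pd (xDir k) U z i ^ 2) (fun k _ => sq_nonneg _)
          (Finset.mem_univ k)
      have h6 : c ^ 2 * pd (xDir k) U z i ^ 2 ≤ 2 * E := by
        have : c ^ 2 * pd (xDir k) U z i ^ 2 ≤ b z.1 ^ 2 * ∑ k, pd (xDir k) U z i ^ 2 := by
          gcongr
        nlinarith [sq_nonneg (U z i), sq_nonneg (pd (tDir n) U z i)]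
      have h7 : pd (xDir k) U z i ^ 2 ≤ 2 / c ^ 2 * E := by
        rw [div_mul_eq_mul_div, le_div_iff₀ (by positivity)]
        linarith
      linarith
    refine max_le ?_ (max_le ?_ ?_)
    · exact (pi_norm_le_iff_of_nonneg (Real.sqrt_nonneg _)).2 h1
    · exact (pi_norm_le_iff_of_nonneg (Real.sqrt_nonneg _)).2 h2
    · exact (pi_norm_le_iff_of_nonneg (Real.sqrt_nonneg _)).2 fun k =>
        (pi_norm_le_iff_of_nonneg (Real.sqrt_nonneg _)).2 (h3 k)
  calc ‖jet U z‖ ^ 2 ≤ √((2 + 2 / c ^ 2) * E) ^ 2 := by gcongr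
    _ = _ := Real.sq_sqrt (by positivity)

/-- If a linear subspace, given as the kernel of a projection, is invariant under the lower order
part of the wave map operator, then the solution stays in it on the domain of dependence of the
part of the initial surface where the data lie in it. -/
theorem IsGlobalSolution.proj_eq_zero (h : IsGlobalSolution b M u₀ u₁ u) (hb : ContDiff ℝ 2 b)
    {c β : ℝ} (hc : 0 < c) (hbc : ∀ t, c ≤ b t) (hbβ : ∀ t, b t ≤ β)
    (P : (Fin m → ℝ) →L[ℝ] (Fin m → ℝ)) (hPP : ∀ p, P (P p) = P p)
    (hP : ∀ q : ℝ × Jet n m, q.2.1 ∈ M.domain → P q.2.1 = 0 → P q.2.2.1 = 0 →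
      (∀ l, P (q.2.2.2 l) = 0) → P (lowerOrder b M q) = 0)
    {t₁ : ℝ} (ht₁ : 0 ≤ t₁) {x₀ : EuclideanSpace ℝ (Fin n)}
    (h0 : ∀ x, ‖x - x₀‖ < β * t₁ + 2 → P (fun i => u₀ i x) = 0)
    (h1 : ∀ x, ‖x - x₀‖ < β * t₁ + 2 → P (fun i => u₁ i x) = 0) :
    P (toMap u (t₁, x₀)) = 0 := by
  have hb0 : ∀ t, 0 < b t := fun t => hc.trans_le (hbc t)
  have hU := h.contDiffOn_toMap
  have hU1 : ContDiffOn ℝ 1 (toMap u) (future n) := hU.of_le (by norm_num)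
  have hPU : ContDiffOn ℝ 2 (fun z => P (toMap u z)) (future n) := P.contDiff.comp_contDiffOn hU
  have hPU1 : ContDiffOn ℝ 1 (fun z => P (toMap u z)) (future n) := hPU.of_le (by norm_num)
  have hjetP : ∀ z ∈ future n, jet (fun z => P (toMap u z)) z =
      (P (toMap u z), P (pd (tDir n) (toMap u) z), fun k => P (pd (xDir k) (toMap u) z)) :=
    fun z hz => by simp only [jet, pd_clm hU1 P _ hz]
  -- The jet of `u` minus the jet of `P u` lies in the kernel of `P`, where the projected
  -- nonlinearity vanishes by invariance. So the source in the equation for `P u` is dominated by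
  -- the jet of `P u`.
  have hlocal : ∀ z₀ ∈ future n, ∃ C : ℝ, 0 ≤ C ∧ ∀ᶠ z in 𝓝[future n] z₀,
      ‖P (lowerOrder (n := n) b M (z.1, jet (toMap u) z))‖ ≤
        C * ‖jet (fun z => P (toMap u z)) z‖ := by
    intro z₀ hz₀
    have hmem : toMap u z₀ ∈ M.domain := h.mem_domain z₀.1 (mem_future.1 hz₀) z₀.2
    refine eventually_norm_le_of_vanishing (Ψ := fun q => P (lowerOrder (n := n) b M q))
      (τ := Prod.fst) continuous_fst.continuousWithinAt (continuousOn_jet hU1 z₀ hz₀)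
      (continuousOn_jet hPU1 z₀ hz₀)
      (P.contDiff.contDiffAt.comp _ (contDiffAt_lowerOrder hb (fun t => (hb0 t).ne') M hmem))
      fun hz => ?_
    have hPz : P (toMap u z₀) = 0 := congrArg Prod.fst hz
    have hcont : ContinuousWithinAt (fun z => toMap u z - P (toMap u z)) (future n) z₀ :=
      (hU.continuousOn z₀ hz₀).sub (hPU.continuousOn z₀ hz₀)
    -- Removing the `P` component could leave the chart; near a point with `P u = 0` it does not,
    -- since the chart is open.
    have hev : ∀ᶠ z in 𝓝[future n] z₀, toMap u z - P (toMap u z) ∈ M.domain :=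
      hcont (M.isOpen_domain.mem_nhds (by simpa only [hPz, sub_zero] using hmem))
    filter_upwards [hev, self_mem_nhdsWithin] with z hz1 hz2
    rw [hjetP z hz2]
    refine hP _ hz1 ?_ ?_ fun l => ?_
    · change P (toMap u z - P (toMap u z)) = 0
      rw [map_sub, hPP, sub_self]
    · change P (pd (tDir n) (toMap u) z - P (pd (tDir n) (toMap u) z)) = 0
      rw [map_sub, hPP, sub_self]
    · change P (pd (xDir l) (toMap u) z - P (pd (xDir l) (toMap u) z)) = 0
      rw [map_sub, hPP, sub_self]
  have hK : IsCompact (Icc 0 t₁ ×ˢ Metric.closedBall x₀ (β * t₁ + 2)) :=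
    isCompact_Icc.prod (isCompact_closedBall _ _)
  obtain ⟨C, hC, hbd⟩ := exists_bound_on_compact hK (fun z hz => mem_future.2 hz.1.1)
    (fun z => norm_nonneg _) hlocal
  funext i
  -- The factor `m` counts the components, each bounded by the sup norm; `2 + 2 / c ^ 2` comes from
  -- `norm_jet_sq_le`.
  refine eq_zero_of_wave_inequality (w := fun i z => P (toMap u z) i)
    (C := m * (C ^ 2 * (2 + 2 / c ^ 2))) (hb.of_le (by norm_num)) hb0 hbβ
    (fun i => contDiffOn_pi.1 hPU i) ht₁ ?_ ?_ ?_ i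
  · intro t ht x hx
    have hz : ((t, x) : ℝ × EuclideanSpace ℝ (Fin n)) ∈ future n := mem_future.2 ht.1.le
    have hzK : ((t, x) : ℝ × EuclideanSpace ℝ (Fin n)) ∈
        Icc 0 t₁ ×ˢ Metric.closedBall x₀ (β * t₁ + 2) :=
      ⟨⟨ht.1.le, ht.2⟩, by rw [Metric.mem_closedBall, dist_eq_norm]; exact hx.le⟩
    have hop : ∀ i, waveOp b (fun z => P (toMap u z) i) (t, x) =
        - P (lowerOrder (n := n) b M (t, jet (toMap u) (t, x))) i := fun i => by
      have e := waveOp_clm (b := b) hU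
        ((ContinuousLinearMap.proj (R := ℝ) (φ := fun _ : Fin m => ℝ) i).comp P) hz
      have e2 : (fun i => waveOp b (fun y => toMap u y i) (t, x)) =
          - lowerOrder (n := n) b M (t, jet (toMap u) (t, x)) :=
        funext fun i => h.waveOp_eq ht.1 x i
      rw [e2, map_neg] at e
      exact e
    simp only [hop, neg_sq]
    have h3 : ∀ i, P (lowerOrder (n := n) b M (t, jet (toMap u) (t, x))) i ^ 2 ≤
        C ^ 2 * (2 + 2 / c ^ 2) * ∑ i, energyDensity b (fun z => P (toMap u z) i) (t, x) := by
      intro i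
      have h4 := (norm_le_pi_norm (P (lowerOrder (n := n) b M (t, jet (toMap u) (t, x)))) i).trans
        (hbd (t, x) hzK)
      rw [Real.norm_eq_abs] at h4
      have h5 := pow_le_pow_left₀ (abs_nonneg _) h4 2
      rw [mul_pow, sq_abs] at h5
      refine h5.trans ?_
      rw [mul_assoc]
      exact mul_le_mul_of_nonneg_left (norm_jet_sq_le hPU1 hc (hbc t) hz) (sq_nonneg C)
    refine (Finset.sum_le_sum fun i _ => h3 i).trans (le_of_eq ?_)
    simp only [Finset.sum_const, Finset.card_univ, Fintype.card_fin, nsmul_eq_mul]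
    ring
  · intro x hx i
    have e : toMap u (0, x) = fun i => u₀ i x := funext fun i => h.initial_value i x
    simp only [e, h0 x hx, Pi.zero_apply]
  · intro x hx i
    have hz : ((0, x) : ℝ × EuclideanSpace ℝ (Fin n)) ∈ future n := mem_future.2 le_rfl
    have e : pd (tDir n) (toMap u) (0, x) = fun i => u₁ i x := funext fun i => by
      rw [← pd_apply hU1 _ hz, ← h.initial_velocity i x]
      exact ((hasDerivWithinAt_time ((h.contDiffOn i).of_le (by norm_num)) le_rfl x).derivWithin
        (uniqueDiffOn_Ici 0 0 self_mem_Ici)).symm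
    rw [pd_apply hPU1 _ hz, pd_clm hU1 P _ hz, e, h1 x hx]
    rfl

end

/-! ### The linearizing function of a distinguished line -/

/-- The function `F` with `F'' = f F'`, `F 0 = 0`, `F' 0 = 1`, which turns wave maps along a
distinguished line into solutions of a linear equation. -/
noncomputable def linearizer (f : ℝ → ℝ) (x : ℝ) : ℝ :=
  ∫ s in (0 : ℝ)..x, Real.exp (∫ r in (0 : ℝ)..s, f r)

section

variable {f : ℝ → ℝ} {J : Set ℝ}

theorem hasDerivAt_primitive {g : ℝ → ℝ} (hJ : IsOpen J) (hJo : J.OrdConnected) (h0 : 0 ∈ J)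
    (hg : ContinuousOn g J) {x : ℝ} (hx : x ∈ J) :
    HasDerivAt (fun y => ∫ r in (0 : ℝ)..y, g r) (g x) x :=
  intervalIntegral.integral_hasDerivAt_right
    ((hg.mono (hJo.uIcc_subset h0 hx)).intervalIntegrable)
    (hg.stronglyMeasurableAtFilter hJ x hx) (hg.continuousAt (hJ.mem_nhds hx))

theorem contDiffOn_primitive {g : ℝ → ℝ} (hJ : IsOpen J) (hJo : J.OrdConnected) (h0 : 0 ∈ J)
    {k : ℕ} (hg : ContDiffOn ℝ k g J) :
    ContDiffOn ℝ (k + 1) (fun y => ∫ r in (0 : ℝ)..y, g r) J := by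
  have hd := fun x (hx : x ∈ J) => hasDerivAt_primitive hJ hJo h0 hg.continuousOn hx
  rw [contDiffOn_succ_iff_deriv_of_isOpen hJ]
  refine ⟨fun x hx => (hd x hx).differentiableAt.differentiableWithinAt, by simp, ?_⟩
  exact hg.congr fun x hx => (hd x hx).deriv

theorem continuousOn_exp_primitive (hJ : IsOpen J) (hJo : J.OrdConnected) (h0 : 0 ∈ J)
    (hf : ContinuousOn f J) : ContinuousOn (fun s => Real.exp (∫ r in (0 : ℝ)..s, f r)) J :=
  fun _ hx => (hasDerivAt_primitive hJ hJo h0 hf hx).exp.continuousAt.continuousWithinAt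

theorem hasDerivAt_linearizer (hJ : IsOpen J) (hJo : J.OrdConnected) (h0 : 0 ∈ J)
    (hf : ContinuousOn f J) {x : ℝ} (hx : x ∈ J) :
    HasDerivAt (linearizer f) (Real.exp (∫ r in (0 : ℝ)..x, f r)) x :=
  hasDerivAt_primitive (g := fun s => Real.exp (∫ r in (0 : ℝ)..s, f r)) hJ hJo h0
    (continuousOn_exp_primitive hJ hJo h0 hf) hx

theorem contDiffOn_linearizer (hJ : IsOpen J) (hJo : J.OrdConnected) (h0 : 0 ∈ J)
    (hf : ContinuousOn f J) : ContDiffOn ℝ 2 (linearizer f) J := by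
  have h1 : ContDiffOn ℝ (1 : ℕ) (fun s => Real.exp (∫ r in (0 : ℝ)..s, f r)) J := by
    have := contDiffOn_primitive (k := 0) hJ hJo h0 (contDiffOn_zero.2 hf)
    simpa using this.exp
  have := contDiffOn_primitive hJ hJo h0 h1
  norm_num at this
  exact this

theorem linearizer_pos (hJ : IsOpen J) (hJo : J.OrdConnected) (h0 : 0 ∈ J)
    (hf : ContinuousOn f J) {x : ℝ} (hx : x ∈ J) (hx0 : 0 < x) : 0 < linearizer f x :=
  intervalIntegral.intervalIntegral_pos_of_pos
    (((continuousOn_exp_primitive hJ hJo h0 hf).mono (hJo.uIcc_subset h0 hx)).intervalIntegrable)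
    (fun _ => Real.exp_pos _) hx0

/-- On the positive side this is a partial integral of a positive function, bounded by the total
one; on the negative side the primitive is nonpositive. -/
theorem linearizer_le (hJ : IsOpen J) (hJo : J.OrdConnected) (h0 : 0 ∈ J)
    (hf : ContinuousOn f J) (hfin : nakanishiOhtaIntegral f (Ioi 0) < ⊤) {x : ℝ} (hx : x ∈ J) :
    linearizer f x ≤ (nakanishiOhtaIntegral f (Ioi 0)).toReal := by
  rcases le_total x 0 with hx0 | hx0
  · refine le_trans ?_ ENNReal.toReal_nonneg
    rw [linearizer, intervalIntegral.integral_symm, neg_nonpos]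
    exact intervalIntegral.integral_nonneg hx0 fun _ _ => (Real.exp_pos _).le
  · have hc := ((continuousOn_exp_primitive hJ hJo h0 hf).mono (hJo.uIcc_subset h0 hx))
    rw [uIcc_of_le hx0] at hc
    rw [linearizer, intervalIntegral.integral_of_le hx0, integral_eq_lintegral_of_nonneg_ae
      (Eventually.of_forall fun _ => (Real.exp_pos _).le)
      ((hc.mono Ioc_subset_Icc_self).aestronglyMeasurable measurableSet_Ioc)]
    exact ENNReal.toReal_mono hfin.ne (lintegral_mono_set fun y hy => hy.1)

theorem neg_le_linearizer (hJ : IsOpen J) (hJo : J.OrdConnected) (h0 : 0 ∈ J)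
    (hf : ContinuousOn f J) (hfin : nakanishiOhtaIntegral f (Iio 0) < ⊤) {x : ℝ} (hx : x ∈ J) :
    -(nakanishiOhtaIntegral f (Iio 0)).toReal ≤ linearizer f x := by
  rw [neg_le]
  rcases le_total 0 x with hx0 | hx0
  · refine le_trans ?_ ENNReal.toReal_nonneg
    rw [linearizer, neg_nonpos]
    exact intervalIntegral.integral_nonneg hx0 fun _ _ => (Real.exp_pos _).le
  · have hc := ((continuousOn_exp_primitive hJ hJo h0 hf).mono (hJo.uIcc_subset hx h0))
    rw [uIcc_of_le hx0] at hc
    rw [linearizer, intervalIntegral.integral_symm, neg_neg, intervalIntegral.integral_of_le hx0,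
      integral_Ioc_eq_integral_Ioo, integral_eq_lintegral_of_nonneg_ae
      (Eventually.of_forall fun _ => (Real.exp_pos _).le)
      ((hc.mono Ioo_subset_Icc_self).aestronglyMeasurable measurableSet_Ioo)]
    exact ENNReal.toReal_mono hfin.ne (lintegral_mono_set fun y hy => hy.2)

end

/-! ### Wave maps with data on a distinguished line -/

section

variable {n m : ℕ} {b : ℝ → ℝ} {M : RiemannianChart m} {a : Fin m → ℝ} {f : ℝ → ℝ}

/-- No regularity of `f` is part of the definition; a nonzero component of `a` lets one solve for
`f` in terms of the Christoffel symbols. -/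
theorem RiemannianChart.IsDistinguishedLine.continuousOn (h : M.IsDistinguishedLine a f) :
    ContinuousOn f {t | t • a ∈ M.domain} := by
  obtain ⟨i, hi⟩ := Function.ne_iff.1 h.ne_zero
  rw [Pi.zero_apply] at hi
  have e : EqOn f (fun t => (∑ j, ∑ k, M.christoffel i j k (t • a) * a j * a k) / a i)
      {t | t • a ∈ M.domain} := fun t ht => by
    simp only [h.coherent t ht i]
    field_simp
  refine ContinuousOn.congr (ContinuousOn.div_const ?_ _) e
  refine continuousOn_finsetSum _ fun j _ => continuousOn_finsetSum _ fun k _ => ?_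
  refine ContinuousOn.mul (ContinuousOn.mul (fun t ht => ?_) continuousOn_const) continuousOn_const
  have h1 : ContinuousAt (M.christoffel i j k) (t • a) :=
    (M.contDiffAt_christoffel ht i j k).continuousAt
  exact (ContinuousAt.comp (f := fun t : ℝ => t • a) h1 (by fun_prop)).continuousWithinAt

/-- This is the invariance of the line: when all parts of the jet are multiples of `a`, the
Christoffel sum contracts to `f` and the result is again a multiple of `a`. -/
theorem RiemannianChart.IsDistinguishedLine.lowerOrder_eq (h : M.IsDistinguishedLine a f)
    {t θ σ : ℝ} {ζ : Fin n → ℝ} (hθ : θ • a ∈ M.domain) :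
    lowerOrder b M (t, (θ • a, σ • a, fun l => ζ l • a)) =
      (f θ * (σ ^ 2 - b t ^ 2 * ∑ l, ζ l ^ 2) - n * (deriv b t / b t) * σ) • a := by
  ext i
  have h1 := h.coherent θ hθ i
  have h2 : ∀ j k, σ * a j * (σ * a k) - b t ^ 2 * ∑ l, ζ l * a j * (ζ l * a k) =
      a j * a k * (σ ^ 2 - b t ^ 2 * ∑ l, ζ l ^ 2) := fun j k => by
    rw [show ∑ l, ζ l * a j * (ζ l * a k) = a j * a k * ∑ l, ζ l ^ 2 by
      rw [Finset.mul_sum]; exact Finset.sum_congr rfl fun l _ => by ring]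
    ring
  simp only [lowerOrder, Pi.smul_apply, smul_eq_mul, h2]
  simp only [← mul_assoc, ← Finset.sum_mul, h1]
  ring

variable {u : Fin m → ℝ → EuclideanSpace ℝ (Fin n) → ℝ} {θ₀ θ₁ : EuclideanSpace ℝ (Fin n) → ℝ}

/-- Solutions with data on a distinguished line stay on the line. -/
theorem IsGlobalSolution.toMap_eq_smul
    (hu : IsGlobalSolution b M (fun i x => θ₀ x * a i) (fun i x => θ₁ x * a i) u)
    (hb : ContDiff ℝ 2 b) {c β : ℝ} (hc : 0 < c) (hbc : ∀ t, c ≤ b t) (hbβ : ∀ t, b t ≤ β)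
    (h : M.IsDistinguishedLine a f) {i₀ : Fin m} (hi₀ : a i₀ ≠ 0)
    {z : ℝ × EuclideanSpace ℝ (Fin n)} (hz : z ∈ future n) :
    toMap u z = (toMap u z i₀ / a i₀) • a := by
  -- The projection with kernel `ℝ a` that subtracts the multiple of `a` matching the coordinate
  -- `i₀`.
  set P : (Fin m → ℝ) →L[ℝ] (Fin m → ℝ) := ContinuousLinearMap.id ℝ _ -
    (ContinuousLinearMap.proj (R := ℝ) (φ := fun _ : Fin m => ℝ) i₀).smulRight ((a i₀)⁻¹ • a)
    with hPdef
  have hP : ∀ p, P p = p - (p i₀ / a i₀) • a := fun p => by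
    simp [hPdef, smul_smul, div_eq_mul_inv]
  have hPa : ∀ s : ℝ, P (s • a) = 0 := fun s => by
    rw [hP, Pi.smul_apply, smul_eq_mul, mul_div_cancel_right₀ _ hi₀, sub_self]
  have hker : ∀ p, P p = 0 → p = (p i₀ / a i₀) • a := fun p hp => by
    rw [hP] at hp
    exact sub_eq_zero.1 hp
  refine hker _ ?_
  refine hu.proj_eq_zero (t₁ := z.1) (x₀ := z.2) hb hc hbc hbβ P (fun p => ?_) ?_
    (mem_future.1 hz) (fun x _ => hPa (θ₀ x)) (fun x _ => hPa (θ₁ x))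
  · conv_lhs => rw [hP p]
    rw [map_sub, hPa, sub_zero]
  · rintro ⟨t, p, ξ, η⟩ hp h1 h2 h3
    have e1 := hker p h1
    have e2 := hker ξ h2
    have e3 : η = fun l => (η l i₀ / a i₀) • a := funext fun l => hker _ (h3 l)
    simp only at hp
    rw [e1] at hp
    rw [e1, e2, e3, h.lowerOrder_eq hp, hPa]

/-- Finite speed of propagation. -/
theorem IsGlobalSolution.toMap_eq_zero {u₀ u₁ : Fin m → EuclideanSpace ℝ (Fin n) → ℝ}
    (hu : IsGlobalSolution b M u₀ u₁ u)
    (hb : ContDiff ℝ 2 b) {c β : ℝ} (hc : 0 < c) (hbc : ∀ t, c ≤ b t) (hbβ : ∀ t, b t ≤ β)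
    {R : ℝ} (h0 : ∀ i x, R ≤ ‖x‖ → u₀ i x = 0) (h1 : ∀ i x, R ≤ ‖x‖ → u₁ i x = 0)
    {t : ℝ} (ht : 0 ≤ t) {x : EuclideanSpace ℝ (Fin n)} (hx : R + (β * t + 2) ≤ ‖x‖) :
    toMap u (t, x) = 0 := by
  have hfar : ∀ y, ‖y - x‖ < β * t + 2 → R ≤ ‖y‖ := fun y hy => by
    have := norm_sub_norm_le x y
    rw [norm_sub_rev] at this
    linarith
  -- With the identity as projection the invariant subspace is `{0}`: the lower order part is zero
  -- when all first derivatives are.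
  refine hu.proj_eq_zero hb hc hbc hbβ (ContinuousLinearMap.id ℝ _) (fun p => rfl) ?_ ht
    (fun y hy => funext fun i => h0 i y (hfar y hy)) (fun y hy => funext fun i => h1 i y (hfar y hy))
  rintro ⟨t, p, ξ, η⟩ - - h2 h3
  simp only [ContinuousLinearMap.id_apply] at h2 h3 ⊢
  ext i
  simp [lowerOrder, h2, h3]

/-- A global wave map with compactly supported data on a distinguished line that violates the
Nakanishi–Ohta condition gives a global solution of the linear equation, bounded on one side. -/
theorem IsGlobalSolution.exists_linear (hn : 1 ≤ n)
    (hu : IsGlobalSolution b M (fun i x => θ₀ x * a i) (fun i x => θ₁ x * a i) u)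
    (hb : ContDiff ℝ 2 b) {c β : ℝ} (hc : 0 < c) (hbc : ∀ t, c ≤ b t) (hbβ : ∀ t, b t ≤ β)
    (h : M.IsDistinguishedLine a f) (hviol : M.ViolatesNakanishiOhta a f)
    {R : ℝ} (h0 : ∀ x, R ≤ ‖x‖ → θ₀ x = 0) (h1 : ∀ x, R ≤ ‖x‖ → θ₁ x = 0) :
    ∃ v : ℝ × EuclideanSpace ℝ (Fin n) → ℝ, ContDiffOn ℝ 2 v (future n) ∧
      (∀ t, 0 < t → ∀ x,
        waveOp b v (t, x) = n * (deriv b t / b t) * pd (tDir n) v (t, x)) ∧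
      (∀ t, 0 ≤ t → ∀ x, R + (β * t + 2) ≤ ‖x‖ → v (t, x) = 0) ∧
      (∃ C, (∀ z ∈ future n, v z ≤ C) ∨ (∀ z ∈ future n, -v z ≤ C)) ∧
      (∀ x, v (0, x) = linearizer f (θ₀ x)) ∧
      (∀ x, 0 < θ₀ x → 0 < linearizer f (θ₀ x)) ∧
      (∀ x, pd (tDir n) v (0, x) = Real.exp (∫ r in (0 : ℝ)..θ₀ x, f r) * θ₁ x) := by
  obtain ⟨i₀, hi₀⟩ := Function.ne_iff.1 h.ne_zero
  rw [Pi.zero_apply] at hi₀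
  set L : (Fin m → ℝ) →L[ℝ] ℝ :=
    (a i₀)⁻¹ • ContinuousLinearMap.proj (R := ℝ) (φ := fun _ : Fin m => ℝ) i₀ with hL
  have hLa : ∀ p, L p = p i₀ / a i₀ := fun p => by simp [hL, div_eq_inv_mul]
  have hLs : ∀ s : ℝ, L (s • a) = s := fun s => by
    rw [hLa, Pi.smul_apply, smul_eq_mul, mul_div_cancel_right₀ _ hi₀]
  set θ : ℝ × EuclideanSpace ℝ (Fin n) → ℝ := fun z => L (toMap u z) with hθdef
  have hU := hu.contDiffOn_toMap
  have hU1 : ContDiffOn ℝ 1 (toMap u) (future n) := hU.of_le (by norm_num)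
  have hθ : ContDiffOn ℝ 2 θ (future n) := L.contDiff.comp_contDiffOn hU
  have hθ1 : ContDiffOn ℝ 1 θ (future n) := hθ.of_le (by norm_num)
  have hUθ : ∀ z ∈ future n, toMap u z = θ z • a := fun z hz => by
    rw [hθdef]
    simp only [hLa]
    exact hu.toMap_eq_smul hb hc hbc hbβ h hi₀ hz
  set S : ℝ →L[ℝ] (Fin m → ℝ) := (ContinuousLinearMap.id ℝ ℝ).smulRight a
  have hpd : ∀ v, ∀ z ∈ future n, pd v (toMap u) z = pd v θ z • a := fun v z hz => by
    have e : pd v (toMap u) z = pd v (fun z => S (θ z)) z :=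
      pd_congr (fun y hy => by simp [S, hUθ y hy]) hz
    rw [e, pd_clm hθ1 S v hz]
    simp [S]
  have hmem : ∀ z ∈ future n, θ z • a ∈ M.domain := fun z hz => by
    rw [← hUθ z hz]
    exact hu.mem_domain z.1 (mem_future.1 hz) z.2
  have hθeq : ∀ t, 0 < t → ∀ x, waveOp b θ (t, x) =
      -(f (θ (t, x)) * (pd (tDir n) θ (t, x) ^ 2 - b t ^ 2 * ∑ l, pd (xDir l) θ (t, x) ^ 2)
        - n * (deriv b t / b t) * pd (tDir n) θ (t, x)) := by
    intro t ht x
    have hz : ((t, x) : ℝ × EuclideanSpace ℝ (Fin n)) ∈ future n := mem_future.2 ht.le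
    rw [hθdef, waveOp_clm hU L hz,
      show (fun i => waveOp b (fun y => toMap u y i) (t, x)) =
        - lowerOrder (n := n) b M (t, jet (toMap u) (t, x)) from
          funext fun i => hu.waveOp_eq ht x i, map_neg]
    congr 1
    have : jet (toMap u) (t, x) = (θ (t, x) • a, pd (tDir n) θ (t, x) • a,
        fun l => pd (xDir l) θ (t, x) • a) := by
      simp only [jet, hpd _ _ hz, hUθ _ hz]
    rw [this, h.lowerOrder_eq (hmem _ hz), hLs]
  -- the values on the line
  set D : Set ℝ := {t | t • a ∈ M.domain} with hD
  have hDo : IsOpen D := M.isOpen_domain.preimage (by fun_prop)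
  have hD0 : (0 : ℝ) ∈ D := by
    simp only [hD, mem_ofPred_eq, zero_smul]
    exact h.zero_mem
  -- The line may meet the chart in several intervals and `f` is controlled only there; the
  -- linearizer is regular on the component of `0`.
  set J : Set ℝ := connectedComponentIn D 0
  have hJo : IsOpen J := hDo.connectedComponentIn
  have hJc : J.OrdConnected := isPreconnected_connectedComponentIn.ordConnected
  have hJ0 : (0 : ℝ) ∈ J := mem_connectedComponentIn hD0
  have hf : ContinuousOn f J := h.continuousOn.mono (connectedComponentIn_subset _ _)
  have hθ0 : ∀ x, θ (0, x) = θ₀ x := fun x => by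
    have : toMap u (0, x) = θ₀ x • a := funext fun i => hu.initial_value i x
    simp only [hθdef, this, hLs]
  have : Nonempty (Fin n) := ⟨⟨0, hn⟩⟩
  have : Nontrivial (EuclideanSpace ℝ (Fin n)) := inferInstance
  -- The image of the connected half space is connected and contains `0`, the value of `θ₀` far from
  -- the origin. Such a far point exists because `n ≥ 1`.
  have hθJ : ∀ z ∈ future n, θ z ∈ J := by
    obtain ⟨x, hx⟩ := NormedSpace.exists_lt_norm ℝ (EuclideanSpace ℝ (Fin n)) R
    have h2 : IsPreconnected (θ '' future n) :=
      convex_future.isPreconnected.image θ hθ.continuousOn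
    have h3 : (0 : ℝ) ∈ θ '' future n :=
      ⟨(0, x), mem_future.2 le_rfl, by rw [hθ0, h0 x hx.le]⟩
    have h4 : θ '' future n ⊆ D := by
      rintro _ ⟨z, hz, rfl⟩
      exact hmem z hz
    intro z hz
    exact h2.subset_connectedComponentIn h3 h4 ⟨z, hz, rfl⟩
  have hF := contDiffOn_linearizer hJo hJc hJ0 hf
  have hF' := fun x (hx : x ∈ J) => hasDerivAt_linearizer hJo hJc hJ0 hf hx
  set g : ℝ → ℝ := fun x => Real.exp (∫ r in (0 : ℝ)..x, f r) with hg
  have hg' : ∀ x ∈ J, HasDerivAt g (g x * f x) x := fun x hx =>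
    (hasDerivAt_primitive hJo hJc hJ0 hf hx).exp
  have hpv : ∀ w, ∀ z ∈ future n, pd w (fun y => linearizer f (θ y)) z = g (θ z) * pd w θ z :=
    fun w z hz => pd_comp hθ1 hz (hF' _ (hθJ z hz))
  have hgθ : ContDiffOn ℝ 1 (fun y => g (θ y)) (future n) := by
    have : ContDiffOn ℝ (0 + 1 : ℕ) (fun y => ∫ r in (0 : ℝ)..y, f r) J := by
      exact_mod_cast contDiffOn_primitive (k := 0) hJo hJc hJ0 (contDiffOn_zero.2 hf)
    exact (this.exp).comp hθ1 hθJ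
  -- Since `g' = f g`, second derivatives of `v` produce the quadratic terms with coefficient `f(θ)`
  -- that cancel those in the equation for `θ`.
  have hppv : ∀ w, ∀ z ∈ future n, pd w (pd w (fun y => linearizer f (θ y))) z =
      g (θ z) * (pd w (pd w θ) z + f (θ z) * pd w θ z ^ 2) := fun w z hz => by
    rw [pd_congr (hpv w) hz, pd_mul hgθ (contDiffOn_pd hθ w) hz,
      pd_comp hθ1 hz (hg' _ (hθJ z hz))]
    ring
  refine ⟨fun z => linearizer f (θ z), hF.comp hθ hθJ, ?_, ?_, ?_, ?_, ?_, ?_⟩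
  · intro t ht x
    have hz : ((t, x) : ℝ × EuclideanSpace ℝ (Fin n)) ∈ future n := mem_future.2 ht.le
    have h2 := hθeq t ht x
    simp only [waveOp] at h2 ⊢
    simp only [hpv _ _ hz, hppv _ _ hz, ← Finset.mul_sum, Finset.sum_add_distrib]
    linear_combination g (θ (t, x)) * h2
  · intro t ht x hx
    have h2 : toMap u (t, x) = 0 := hu.toMap_eq_zero hb hc hbc hbβ
      (fun i y hy => by rw [h0 y hy, zero_mul]) (fun i y hy => by rw [h1 y hy, zero_mul]) ht hx
    simp [hθdef, h2, linearizer]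
  · rcases hviol with ⟨-, h2⟩ | ⟨-, h2⟩
    · exact ⟨_, Or.inl fun z hz => linearizer_le hJo hJc hJ0 hf h2 (hθJ z hz)⟩
    · exact ⟨_, Or.inr fun z hz => neg_le.1 (neg_le_linearizer hJo hJc hJ0 hf h2 (hθJ z hz))⟩
  · intro x
    simp only [hθ0]
  · intro x hx
    refine linearizer_pos hJo hJc hJ0 hf ?_ hx
    rw [← hθ0]
    exact hθJ _ (mem_future.2 le_rfl)
  · intro x
    have hz : ((0, x) : ℝ × EuclideanSpace ℝ (Fin n)) ∈ future n := mem_future.2 le_rfl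
    rw [hpv _ _ hz, hθ0, hg]
    congr 1
    have e : pd (tDir n) (toMap u) (0, x) = θ₁ x • a := funext fun i => by
      rw [← pd_apply hU1 _ hz]
      have h3 := hu.initial_velocity i x
      rw [Pi.smul_apply, smul_eq_mul, ← h3]
      exact ((hasDerivWithinAt_time ((hu.contDiffOn i).of_le (by norm_num)) le_rfl x).derivWithin
        (uniqueDiffOn_Ici 0 0 self_mem_Ici)).symm
    rw [hθdef, pd_clm hU1 L _ hz, e, hLs]

end

/-! ### Growth for unstable Hill equations -/

/-- `y`, with derivative `y'`, solves `y'' + p y = 0` on the half line `[0, ∞)`. -/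
structure IsHalfLineSolution (p y y' : ℝ → ℝ) : Prop where
  continuousOn : ContinuousOn y (Ici 0)
  continuousOn_deriv : ContinuousOn y' (Ici 0)
  hasDerivAt : ∀ t, 0 < t → HasDerivAt y (y' t) t
  hasDerivAt_deriv : ∀ t, 0 < t → HasDerivAt y' (-(p t * y t)) t

/-- At most polynomial growth on `[0, ∞)`. -/
def HasPolynomialGrowth (y : ℝ → ℝ) : Prop :=
  ∃ (K : ℝ) (N : ℕ), ∀ t, 0 ≤ t → |y t| ≤ K * (1 + t) ^ N

theorem IsHalfLineSolution.combination {p y y' z z' : ℝ → ℝ} (hy : IsHalfLineSolution p y y')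
    (hz : IsHalfLineSolution p z z') (α γ : ℝ) :
    IsHalfLineSolution p (fun t => α * y t + γ * z t) (fun t => α * y' t + γ * z' t) where
  continuousOn := (hy.continuousOn.const_mul α).add (hz.continuousOn.const_mul γ)
  continuousOn_deriv := (hy.continuousOn_deriv.const_mul α).add (hz.continuousOn_deriv.const_mul γ)
  hasDerivAt t ht := ((hy.hasDerivAt t ht).const_mul α).add ((hz.hasDerivAt t ht).const_mul γ)
  hasDerivAt_deriv t ht := by
    refine (((hy.hasDerivAt_deriv t ht).const_mul α).fun_add
      ((hz.hasDerivAt_deriv t ht).const_mul γ)).congr_deriv ?_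
    ring

theorem IsHalfLineSolution.shift {p y y' : ℝ → ℝ} (hy : IsHalfLineSolution p y y') {T : ℝ}
    (hT : 0 ≤ T) (hp : Function.Periodic p T) :
    IsHalfLineSolution p (fun t => y (t + T)) (fun t => y' (t + T)) where
  continuousOn := hy.continuousOn.comp (by fun_prop) fun t ht => by
    simp only [mem_Ici] at ht ⊢; linarith
  continuousOn_deriv := hy.continuousOn_deriv.comp (by fun_prop) fun t ht => by
    simp only [mem_Ici] at ht ⊢; linarith
  hasDerivAt t ht := (hy.hasDerivAt (t + T) (by linarith)).comp_add_const t T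
  hasDerivAt_deriv t ht := by
    have := (hy.hasDerivAt_deriv (t + T) (by linarith)).comp_add_const t T
    rwa [hp t] at this

/-- Grönwall for `y² + y'²`, whose derivative `2 (1 - p) y y'` is at most `(1 + C)(y² + y'²)` when
`|p| ≤ C`. -/
theorem IsHalfLineSolution.eq_zero {p y y' : ℝ → ℝ} (hp : Continuous p)
    (hy : IsHalfLineSolution p y y') (h0 : y 0 = 0) (h0' : y' 0 = 0) {t : ℝ} (ht : 0 ≤ t) :
    y t = 0 := by
  obtain ⟨C, hC⟩ := (isCompact_Icc (a := (0 : ℝ)) (b := t)).exists_bound_of_continuousOn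
    hp.continuousOn
  set K := 1 + C
  have hanti : AntitoneOn (fun s => Real.exp (-(K * s)) * (y s ^ 2 + y' s ^ 2)) (Icc 0 t) := by
    have hd : ∀ s ∈ Ioo 0 t, HasDerivAt (fun s => Real.exp (-(K * s)) * (y s ^ 2 + y' s ^ 2))
        (Real.exp (-(K * s)) * -(K * 1) * (y s ^ 2 + y' s ^ 2) + Real.exp (-(K * s)) *
          (2 * y s * y' s + 2 * y' s * -(p s * y s))) s := fun s hs => by
      refine HasDerivAt.mul ((hasDerivAt_id s).const_mul K).neg.exp (HasDerivAt.fun_add ?_ ?_)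
      · exact ((hy.hasDerivAt s hs.1).fun_pow 2).congr_deriv (by norm_num)
      · exact ((hy.hasDerivAt_deriv s hs.1).fun_pow 2).congr_deriv (by norm_num)
    have hsub : Icc 0 t ⊆ Ici 0 := Icc_subset_Ici_self
    refine antitoneOn_of_deriv_nonpos (convex_Icc _ _) ?_ ?_ ?_
    · exact ContinuousOn.mul (by fun_prop) (((hy.continuousOn.mono hsub).pow 2).add
        ((hy.continuousOn_deriv.mono hsub).pow 2))
    · rw [interior_Icc]
      exact fun s hs => (hd s hs).differentiableAt.differentiableWithinAt
    · rw [interior_Icc]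
      intro s hs
      rw [(hd s hs).deriv]
      have h1 := abs_le.1 (hC s ⟨hs.1.le, hs.2.le⟩)
      have h2 : 2 * y s * y' s + 2 * y' s * -(p s * y s) ≤ K * (y s ^ 2 + y' s ^ 2) := by
        nlinarith [sq_nonneg (y s + y' s), sq_nonneg (y s - y' s),
          mul_nonneg (by linarith [h1.1] : 0 ≤ C + p s) (sq_nonneg (y s - y' s)),
          mul_nonneg (by linarith [h1.2] : 0 ≤ C - p s) (sq_nonneg (y s + y' s))]
      nlinarith [Real.exp_pos (-(K * s))]
  have h := hanti ⟨le_rfl, ht⟩ ⟨ht, le_rfl⟩ ht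
  simp only [h0, h0', ne_eq, OfNat.ofNat_ne_zero, not_false_eq_true, zero_pow, add_zero,
    mul_zero] at h
  have h2 : y t ^ 2 + y' t ^ 2 ≤ 0 := by
    by_contra hcon
    push Not at hcon
    linarith [mul_pos (Real.exp_pos (-(K * t))) hcon]
  have h3 : y t ^ 2 = 0 := by nlinarith [sq_nonneg (y t), sq_nonneg (y' t)]
  exact pow_eq_zero_iff two_ne_zero |>.1 h3

/-- Representation by the normalized fundamental system. -/
theorem IsHalfLineSolution.eq_combination {p y y' y₁ y₁' y₂ y₂' : ℝ → ℝ} (hp : Continuous p)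
    (hy : IsHalfLineSolution p y y') (h₁ : IsHalfLineSolution p y₁ y₁')
    (h₂ : IsHalfLineSolution p y₂ y₂') (e₁ : y₁ 0 = 1) (e₁' : y₁' 0 = 0) (e₂ : y₂ 0 = 0)
    (e₂' : y₂' 0 = 1) {t : ℝ} (ht : 0 ≤ t) : y t = y 0 * y₁ t + y' 0 * y₂ t := by
  have := (hy.combination (h₁.combination h₂ (y 0) (y' 0)) 1 (-1)).eq_zero hp
    (by simp [e₁, e₂]) (by simp [e₁', e₂']) ht
  linarith

/-- The root of larger modulus of `μ² - D μ + 1`; negative `D` is reduced to positive `D` by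
changing the sign of `μ`. -/
theorem exists_multiplier {D : ℝ} (hD : 2 < |D|) : ∃ μ : ℝ, 1 < |μ| ∧ μ + μ⁻¹ = D := by
  have key : ∀ D : ℝ, 2 < D → ∃ μ : ℝ, 1 < μ ∧ μ + μ⁻¹ = D := fun D hD => by
    have hs := Real.sq_sqrt (show (0 : ℝ) ≤ D ^ 2 - 4 by nlinarith)
    have hs0 := Real.sqrt_nonneg (D ^ 2 - 4)
    refine ⟨(D + √(D ^ 2 - 4)) / 2, by linarith, ?_⟩
    have hne : (D + √(D ^ 2 - 4)) / 2 ≠ 0 := by positivity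
    field_simp
    nlinarith
  rcases lt_abs.1 hD with h | h
  · obtain ⟨μ, h1, h2⟩ := key D h
    exact ⟨μ, h1.trans_le (le_abs_self μ), h2⟩
  · obtain ⟨μ, h1, h2⟩ := key (-D) h
    exact ⟨-μ, by rw [abs_neg]; exact h1.trans_le (le_abs_self μ), by rw [inv_neg]; linarith⟩

/-- A sequence-like recursion with multiplier `μ`, `|μ| > 1`, and polynomial growth forces the
decaying multiplier. -/
theorem eq_of_recursion_of_growth {y : ℝ → ℝ} {T D μ : ℝ} (hT : 0 < T) (hμ : 1 < |μ|)
    (hD : μ + μ⁻¹ = D) (hrec : ∀ t, 0 ≤ t → y (t + T + T) = D * y (t + T) - y t)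
    (hy : HasPolynomialGrowth y) {t : ℝ} (ht : 0 ≤ t) : y (t + T) = μ⁻¹ * y t := by
  obtain ⟨K, N, hK⟩ := hy
  have hμ0 : μ ≠ 0 := fun h => by simp [h] at hμ; linarith
  -- The component along the growing Floquet direction: the recursion gives `d (s + T) = μ d s`, so
  -- polynomial growth forces `d = 0`.
  set d : ℝ → ℝ := fun s => y (s + T) - μ⁻¹ * y s with hd
  have hstep : ∀ s, 0 ≤ s → d (s + T) = μ * d s := fun s hs => by
    simp only [hd]
    rw [hrec s hs, ← hD]
    field_simp
    ring
  have hpow : ∀ k : ℕ, d (t + k * T) = μ ^ k * d t := fun k => by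
    induction k with
    | zero => simp
    | succ k ih =>
      have h2 : t + (k + 1 : ℕ) * T = t + k * T + T := by push_cast; ring
      rw [h2, hstep _ (by positivity), ih]
      ring
  have hinv : |μ⁻¹| ≤ 1 := by
    rw [abs_inv]
    exact inv_le_one_of_one_le₀ hμ.le
  set A := 1 + t + T
  have hA : 0 < A := by positivity
  have hK0 : 0 ≤ K := by
    have := hK 0 le_rfl
    simp at this
    exact (abs_nonneg _).trans this
  have hbound : ∀ k : ℕ, |μ| ^ k * |d t| ≤ 2 * K * A ^ N * ((k + 1 : ℕ) : ℝ) ^ N := fun k => by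
    rw [← abs_pow, ← abs_mul, ← hpow k]
    have hnn : 0 ≤ t + k * T := by positivity
    have e1 : (1 + (t + k * T + T)) ≤ A * ((k + 1 : ℕ) : ℝ) := by
      have : 0 ≤ (k : ℝ) * (1 + t) := by positivity
      simp only [A]; push_cast; nlinarith
    have e0 : 1 + (t + k * T) ≤ A * ((k + 1 : ℕ) : ℝ) := by linarith
    have h1 := hK (t + k * T + T) (by linarith)
    have h2 := hK (t + k * T) hnn
    have p1 : K * (1 + (t + k * T + T)) ^ N ≤ K * (A * ((k + 1 : ℕ) : ℝ)) ^ N := by gcongr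
    have p2 : K * (1 + (t + k * T)) ^ N ≤ K * (A * ((k + 1 : ℕ) : ℝ)) ^ N := by gcongr
    calc |d (t + k * T)| ≤ |y (t + k * T + T)| + |μ⁻¹ * y (t + k * T)| := abs_sub _ _
      _ ≤ |y (t + k * T + T)| + 1 * |y (t + k * T)| := by rw [abs_mul]; gcongr
      _ ≤ K * (A * ((k + 1 : ℕ) : ℝ)) ^ N + K * (A * ((k + 1 : ℕ) : ℝ)) ^ N := by linarith
      _ = _ := by rw [mul_pow]; ring
  have hlim : Tendsto (fun k : ℕ => 2 * K * A ^ N * |μ| * (((k + 1 : ℕ) : ℝ) ^ N / |μ| ^ (k + 1)))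
      atTop (𝓝 0) := by
    have := ((tendsto_pow_const_div_const_pow_of_one_lt N hμ).comp (tendsto_add_atTop_nat 1)).const_mul
      (2 * K * A ^ N * |μ|)
    simpa using this
  have hle : |d t| ≤ 0 := by
    refine ge_of_tendsto' hlim fun k => ?_
    have hp : 0 < |μ| ^ k := by positivity
    have h3 := hbound k
    rw [mul_comm, ← le_div_iff₀ hp] at h3
    refine h3.trans (le_of_eq ?_)
    rw [pow_succ]
    field_simp
  have h4 : d t = 0 := abs_eq_zero.1 (le_antisymm hle (abs_nonneg _))
  simp only [hd] at h4
  linarith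

theorem periodic_deriv {g : ℝ → ℝ} {T : ℝ} (hg : Function.Periodic g T) :
    Function.Periodic (deriv g) T := fun t => by
  rw [← deriv_comp_add_const]
  congr 1
  exact funext hg

section

variable {b : ℝ → ℝ} {n : ℕ} {T lam : ℝ}

theorem IsHillSolution.isHalfLineSolution {y : ℝ → ℝ} (hy : IsHillSolution b n lam y) :
    IsHalfLineSolution (fun t => lam * b t ^ 2 - potential b n t) y (deriv y) := by
  have hc : ContDiff ℝ (1 + 1) y := by norm_num; exact hy.contDiff
  have hd := contDiff_succ_iff_deriv.1 hc
  refine ⟨hy.contDiff.continuous.continuousOn, hd.2.2.continuous.continuousOn,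
    fun t _ => (hd.1 t).hasDerivAt, fun t _ => ?_⟩
  have h := (hd.2.2.differentiable (by norm_num) t).hasDerivAt
  rwa [eq_neg_of_add_eq_zero_left (hy.equation t)] at h

/-- Used to see that the monodromy matrix has determinant `1`. -/
theorem IsHillSolution.wronskian_eq {y z : ℝ → ℝ} (hy : IsHillSolution b n lam y)
    (hz : IsHillSolution b n lam z) (t : ℝ) :
    y t * deriv z t - deriv y t * z t = y 0 * deriv z 0 - deriv y 0 * z 0 := by
  have hcy : ContDiff ℝ (1 + 1) y := by norm_num; exact hy.contDiff
  have hcz : ContDiff ℝ (1 + 1) z := by norm_num; exact hz.contDiff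
  have hdy := contDiff_succ_iff_deriv.1 hcy
  have hdz := contDiff_succ_iff_deriv.1 hcz
  have hder : ∀ s, HasDerivAt (fun s => y s * deriv z s - deriv y s * z s) 0 s := fun s => by
    have h1 := (hdy.1 s).hasDerivAt
    have h2 := (hdz.1 s).hasDerivAt
    have h3 := (hdy.2.2.differentiable (by norm_num) s).hasDerivAt
    have h4 := (hdz.2.2.differentiable (by norm_num) s).hasDerivAt
    refine ((h1.fun_mul h4).fun_sub (h3.fun_mul h2)).congr_deriv ?_
    linear_combination y s * hz.equation s - z s * hy.equation s
  exact is_const_of_deriv_eq_zero (fun s => (hder s).differentiableAt)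
    (fun s => (hder s).deriv) t 0

theorem continuous_hill_coefficient (hb : ContDiff ℝ 2 b) (hb0 : ∀ t, b t ≠ 0) (n : ℕ) (lam : ℝ) :
    Continuous fun t => lam * b t ^ 2 - potential b n t := by
  have hc : ContDiff ℝ (1 + 1) b := by norm_num; exact hb
  have hd := (contDiff_succ_iff_deriv.1 hc).2.2
  have h1 := hd.continuous_deriv (by norm_num)
  have h2 := hd.continuous
  have h3 := hb.continuous
  unfold potential
  exact (continuous_const.mul (h3.pow 2)).sub ((continuous_const.mul ((h2.div h3 hb0).pow 2)).sub
    (continuous_const.mul (h1.div h3 hb0)))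

/-- For an unstable Hill equation the solutions of polynomial growth cannot contain both the
solution with data `(0, 1)` and a solution with data `(1, κ)`. -/
theorem IsUnstable.growth (hu : IsUnstable b n T lam) (hT : 0 < T) (hb : ContDiff ℝ 2 b)
    (hb0 : ∀ t, b t ≠ 0) (hper : Function.Periodic b T) (κ : ℝ) :
    (∀ y y', IsHalfLineSolution (fun t => lam * b t ^ 2 - potential b n t) y y' →
      y 0 = 0 → y' 0 ≠ 0 → ¬ HasPolynomialGrowth y) ∨
    (∀ y y', IsHalfLineSolution (fun t => lam * b t ^ 2 - potential b n t) y y' →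
      y 0 ≠ 0 → y' 0 = κ * y 0 → ¬ HasPolynomialGrowth y) := by
  obtain ⟨y₁, y₂, hy₁, e₁, e₁', hy₂, e₂, e₂', hD⟩ := hu
  set p : ℝ → ℝ := fun t => lam * b t ^ 2 - potential b n t with hpdef
  have hp : Continuous p := continuous_hill_coefficient hb hb0 n lam
  have hpp : Function.Periodic p T := fun t => by
    simp only [hpdef, potential, hper t, periodic_deriv hper t,
      periodic_deriv (periodic_deriv hper) t]
  have h₁ := hy₁.isHalfLineSolution
  have h₂ := hy₂.isHalfLineSolution
  obtain ⟨μ, hμ, hμD⟩ := exists_multiplier hD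
  have s₁ : ∀ t, 0 ≤ t → y₁ (t + T) = y₁ T * y₁ t + deriv y₁ T * y₂ t := fun t ht => by
    simpa using (h₁.shift hT.le hpp).eq_combination hp h₁ h₂ e₁ e₁' e₂ e₂' ht
  have s₂ : ∀ t, 0 ≤ t → y₂ (t + T) = y₂ T * y₁ t + deriv y₂ T * y₂ t := fun t ht => by
    simpa using (h₂.shift hT.le hpp).eq_combination hp h₁ h₂ e₁ e₁' e₂ e₂' ht
  have hW := hy₁.wronskian_eq hy₂ T
  rw [e₁, e₁', e₂, e₂'] at hW
  -- Cayley–Hamilton for the monodromy matrix, with determinant `1`.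
  have hrec : ∀ α γ : ℝ, ∀ t, 0 ≤ t →
      (fun t => α * y₁ t + γ * y₂ t) (t + T + T) =
        (y₁ T + deriv y₂ T) * (fun t => α * y₁ t + γ * y₂ t) (t + T) -
          (fun t => α * y₁ t + γ * y₂ t) t := by
    intro α γ t ht
    have ht' : 0 ≤ t + T := by linarith
    simp only [s₁ _ ht', s₂ _ ht', s₁ _ ht, s₂ _ ht]
    linear_combination (-α * y₁ t - γ * y₂ t) * hW
  have hdecay : ∀ y y', IsHalfLineSolution p y y' → HasPolynomialGrowth y → ∀ t, 0 ≤ t →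
      y 0 * y₁ (t + T) + y' 0 * y₂ (t + T) = μ⁻¹ * (y 0 * y₁ t + y' 0 * y₂ t) := by
    rintro y y' hy ⟨K, N, hK⟩ t ht
    refine eq_of_recursion_of_growth (y := fun t => y 0 * y₁ t + y' 0 * y₂ t) hT hμ hμD (hrec (y 0) (y' 0)) ⟨K, N, fun s hs => ?_⟩ ht
    simp only [← hy.eq_combination hp h₁ h₂ e₁ e₁' e₂ e₂' hs]
    exact hK s hs
  -- The alternative is whether `y₂` decays with multiplier `1/μ`. If it does and a solution with
  -- data proportional to `(1, κ)` also has polynomial growth, then `y₁` decays too; the diagonal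
  -- entries become `1/μ` and, by the Wronskian, `μ`. Then `y₂` is multiplied by both `μ` and `1/μ`
  -- over a period, hence vanishes, against `y₂' 0 = 1`.
  by_cases hdec : ∀ t, 0 ≤ t → y₂ (t + T) = μ⁻¹ * y₂ t
  · right
    intro y y' hy hy0 hy0' hgrow
    have h3 : ∀ t, 0 ≤ t → y₁ (t + T) = μ⁻¹ * y₁ t := fun t ht => by
      have h4 := hdecay y y' hy hgrow t ht
      rw [hy0', hdec t ht] at h4
      have h5 : y 0 * (y₁ (t + T) - μ⁻¹ * y₁ t) = 0 := by linear_combination h4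
      rcases mul_eq_zero.1 h5 with h | h
      · exact absurd h hy0
      · linarith
    have a1 : y₁ T = μ⁻¹ := by simpa [e₁] using h3 0 le_rfl
    have a2 : y₂ T = 0 := by simpa [e₂] using hdec 0 le_rfl
    rw [a1, a2] at hW
    have hμ0 : μ ≠ 0 := fun h => by simp [h] at hμ; linarith
    have a3 : deriv y₂ T = μ := by
      field_simp at hW
      linarith
    have h6 : ∀ t, 0 ≤ t → y₂ t = 0 := fun t ht => by
      have h7 := s₂ t ht
      rw [hdec t ht, a2, a3] at h7
      have h8 : (μ - μ⁻¹) * y₂ t = 0 := by linear_combination -h7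
      rcases mul_eq_zero.1 h8 with h | h
      · exfalso
        have : μ * μ = 1 := by
          have := mul_inv_cancel₀ hμ0
          rwa [← sub_eq_zero.1 h] at this
        nlinarith [abs_mul_abs_self μ]
      · exact h
    have hz : HasDerivWithinAt y₂ 0 (Ici 0) 0 :=
      (hasDerivWithinAt_const (0 : ℝ) (Ici 0) (0 : ℝ)).congr (fun t ht => h6 t ht) (h6 0 le_rfl)
    have hz2 : HasDerivWithinAt y₂ (deriv y₂ 0) (Ici 0) 0 :=
      ((hy₂.contDiff.differentiable (by norm_num)) 0).hasDerivAt.hasDerivWithinAt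
    have := (uniqueDiffOn_Ici (0 : ℝ) 0 self_mem_Ici).eq_deriv _ hz hz2
    rw [e₂'] at this
    norm_num at this
  · left
    intro y y' hy hy0 hy0' hgrow
    refine hdec fun t ht => ?_
    have h4 := hdecay y y' hy hgrow t ht
    rw [hy0] at h4
    have h5 : y' 0 * (y₂ (t + T) - μ⁻¹ * y₂ t) = 0 := by linear_combination h4
    rcases mul_eq_zero.1 h5 with h | h
    · exact absurd h hy0'
    · linarith

/-- Removal of the damping term: `c = b^(n/2) y`. -/
theorem isHalfLineSolution_of_damped (hb : ContDiff ℝ 2 b) (hb0 : ∀ t, 0 < b t)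
    {c c' : ℝ → ℝ} (hc : ContinuousOn c (Ici 0)) (hc' : ContinuousOn c' (Ici 0))
    (hd : ∀ t, 0 < t → HasDerivAt c (c' t) t)
    (hd' : ∀ t, 0 < t →
      HasDerivAt c' (n * (deriv b t / b t) * c' t - lam * b t ^ 2 * c t) t) :
    IsHalfLineSolution (fun t => lam * b t ^ 2 - potential b n t)
      (fun t => b t ^ (-(n / 2 : ℝ)) * c t)
      (fun t => b t ^ (-(n / 2 : ℝ)) * (c' t - n / 2 * (deriv b t / b t) * c t)) := by
  have hcb : ContDiff ℝ (1 + 1) b := by norm_num; exact hb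
  have hb1 := contDiff_succ_iff_deriv.1 hcb
  have hB : Continuous fun t => b t ^ (-(n / 2 : ℝ)) :=
    hb.continuous.rpow_const fun t => Or.inl (hb0 t).ne'
  have hq : Continuous fun t => deriv b t / b t :=
    hb1.2.2.continuous.div hb.continuous fun t => (hb0 t).ne'
  have hBd : ∀ t, HasDerivAt (fun t => b t ^ (-(n / 2 : ℝ)))
      (-(n / 2 : ℝ) * (deriv b t / b t) * b t ^ (-(n / 2 : ℝ))) t := fun t => by
    refine ((hb1.1 t).hasDerivAt.rpow_const (p := -(n / 2 : ℝ))
      (Or.inl (hb0 t).ne')).congr_deriv ?_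
    rw [Real.rpow_sub_one (hb0 t).ne']
    field_simp
  have hqd : ∀ t, HasDerivAt (fun t => deriv b t / b t)
      (deriv (deriv b) t / b t - (deriv b t / b t) ^ 2) t := fun t => by
    refine (((hb1.2.2.differentiable (by norm_num)) t).hasDerivAt.fun_div (hb1.1 t).hasDerivAt
      (hb0 t).ne').congr_deriv ?_
    have := (hb0 t).ne'
    field_simp
  refine ⟨hB.continuousOn.mul hc, hB.continuousOn.mul
    (hc'.sub ((continuous_const.mul hq).continuousOn.mul hc)), fun t ht => ?_, fun t ht => ?_⟩
  · refine ((hBd t).fun_mul (hd t ht)).congr_deriv ?_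
    ring
  · refine ((hBd t).fun_mul ((hd' t ht).fun_sub
      (((hqd t).const_mul (n / 2 : ℝ)).fun_mul (hd t ht)))).congr_deriv ?_
    simp only [potential]
    ring

end

/-! ### Cosine modes of solutions of the linear equation -/

/-- The cosine mode with frequency `κ` of the time slices of a function. -/
noncomputable def cosMode {n : ℕ} (κ : EuclideanSpace ℝ (Fin n))
    (v : ℝ × EuclideanSpace ℝ (Fin n) → ℝ) (t : ℝ) : ℝ :=
  ∫ x, v (t, x) * Real.cos (inner ℝ κ x)

section

variable {n : ℕ} {b : ℝ → ℝ} {v : ℝ × EuclideanSpace ℝ (Fin n) → ℝ}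

theorem contDiffOn_inner_snd (κ : EuclideanSpace ℝ (Fin n)) {k : WithTop ℕ∞} :
    ContDiffOn ℝ k (fun z : ℝ × EuclideanSpace ℝ (Fin n) => inner ℝ κ z.2) (future n) :=
  (contDiff_const.inner ℝ contDiff_snd).contDiffOn

theorem pd_inner_snd (κ : EuclideanSpace ℝ (Fin n)) {w z : ℝ × EuclideanSpace ℝ (Fin n)}
    (hz : z ∈ future n) : pd w (fun z => inner ℝ κ z.2) z = inner ℝ κ w.2 := by
  have h : HasFDerivAt (fun z : ℝ × EuclideanSpace ℝ (Fin n) => inner ℝ κ z.2)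
      ((innerSL ℝ κ).comp (ContinuousLinearMap.snd ℝ ℝ _)) z :=
    ((innerSL ℝ κ).comp (ContinuousLinearMap.snd ℝ ℝ _)).hasFDerivAt
  rw [pd, h.hasFDerivWithinAt.fderivWithin (uniqueDiffOn_future z hz)]
  rfl

theorem pd_mul_cos {W : ℝ × EuclideanSpace ℝ (Fin n) → ℝ} (hW : ContDiffOn ℝ 1 W (future n))
    (κ : EuclideanSpace ℝ (Fin n)) {w z : ℝ × EuclideanSpace ℝ (Fin n)} (hz : z ∈ future n) :
    pd w (fun z => W z * Real.cos (inner ℝ κ z.2)) z =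
      pd w W z * Real.cos (inner ℝ κ z.2) - W z * Real.sin (inner ℝ κ z.2) * inner ℝ κ w.2 := by
  rw [pd_mul hW (contDiffOn_inner_snd κ).cos hz,
    pd_comp (contDiffOn_inner_snd κ) hz (Real.hasDerivAt_cos _), pd_inner_snd κ hz]
  ring

theorem pd_mul_sin {W : ℝ × EuclideanSpace ℝ (Fin n) → ℝ} (hW : ContDiffOn ℝ 1 W (future n))
    (κ : EuclideanSpace ℝ (Fin n)) {w z : ℝ × EuclideanSpace ℝ (Fin n)} (hz : z ∈ future n) :
    pd w (fun z => W z * Real.sin (inner ℝ κ z.2)) z =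
      pd w W z * Real.sin (inner ℝ κ z.2) + W z * Real.cos (inner ℝ κ z.2) * inner ℝ κ w.2 := by
  rw [pd_mul hW (contDiffOn_inner_snd κ).sin hz,
    pd_comp (contDiffOn_inner_snd κ) hz (Real.hasDerivAt_sin _), pd_inner_snd κ hz]
  ring

/-- Time slices have compact support, locally uniformly in time. -/
def HasSliceSupport (v : ℝ × EuclideanSpace ℝ (Fin n) → ℝ) : Prop :=
  ∀ τ, ∃ R, ∀ t ∈ Ico 0 τ, ∀ x, R < ‖x‖ → v (t, x) = 0

theorem HasSliceSupport.pd (hv : HasSliceSupport v) (w : ℝ × EuclideanSpace ℝ (Fin n)) :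
    HasSliceSupport (pd w v) := fun τ => by
  obtain ⟨R, hR⟩ := hv τ
  exact ⟨R, fun t ht x hx => pd_eq_zero_of_support hR ht hx⟩

theorem integrable_cosMode (hv : ContinuousOn v (future n)) (hs : HasSliceSupport v)
    (κ : EuclideanSpace ℝ (Fin n)) {t : ℝ} (ht : 0 ≤ t) :
    Integrable fun x => v (t, x) * Real.cos (inner ℝ κ x) := by
  obtain ⟨R, hR⟩ := hs (t + 1)
  exact integrable_slice (g := fun z => v z * Real.cos (inner ℝ κ z.2)) (R := R)
    (hv.mul (contDiffOn_inner_snd (k := 0) κ).cos.continuousOn) ht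
    fun x hx => by simp only [hR t ⟨ht, by linarith⟩ x hx, zero_mul]

theorem continuousOn_cosMode (hv : ContinuousOn v (future n)) (hs : HasSliceSupport v)
    (κ : EuclideanSpace ℝ (Fin n)) : ContinuousOn (cosMode κ v) (Ici 0) := by
  intro t ht
  obtain ⟨R, hR⟩ := hs (t + 2)
  have h := continuousOn_integral_slice (g := fun z => v z * Real.cos (inner ℝ κ z.2))
    (τ := t + 1) (R := R) (hv.mul (contDiffOn_inner_snd (k := 0) κ).cos.continuousOn)
    fun s hs x hx => by simp only [hR s ⟨hs.1, by linarith [hs.2]⟩ x hx, zero_mul]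
  refine (h t ⟨ht, by linarith⟩).mono_of_mem_nhdsWithin ?_
  exact inter_mem_nhdsWithin _ (Iic_mem_nhds (by linarith))

theorem hasDerivAt_cosMode (hv : ContDiffOn ℝ 1 v (future n)) (hs : HasSliceSupport v)
    (κ : EuclideanSpace ℝ (Fin n)) {t : ℝ} (ht : 0 < t) :
    HasDerivAt (cosMode κ v) (cosMode κ (pd (tDir n) v) t) t := by
  obtain ⟨R, hR⟩ := hs (t + 1)
  have h := hasDerivAt_integral_slice (g := fun z => v z * Real.cos (inner ℝ κ z.2))
    (τ := t + 1) (R := R) (hv.mul (contDiffOn_inner_snd κ).cos)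
    (fun s hs x hx => by simp only [hR s hs x hx, zero_mul]) (t := t) ⟨ht, by linarith⟩
  refine h.congr_deriv (integral_congr_ae (Eventually.of_forall fun x => ?_))
  simp only [pd_mul_cos hv κ (mem_future.2 ht.le : ((t, x) : ℝ × _) ∈ future n)]
  simp [tDir]

/-- Two integrations by parts at once: `∂_k (∂_k v cos + κ_k v sin) = (∂_k² v + κ_k² v) cos`, since
the terms with `∂_k v sin` cancel. -/
theorem cosMode_pd_pd (hv : ContDiffOn ℝ 2 v (future n)) (hs : HasSliceSupport v)
    (κ : EuclideanSpace ℝ (Fin n)) {t : ℝ} (ht : 0 ≤ t) (k : Fin n) :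
    cosMode κ (pd (xDir k) (pd (xDir k) v)) t = -(κ k ^ 2 * cosMode κ v t) := by
  have hv1 : ContDiffOn ℝ 1 v (future n) := hv.of_le (by norm_num)
  have hvk := contDiffOn_pd hv (xDir k)
  obtain ⟨R, hR⟩ := hs (t + 1)
  have htI : t ∈ Ico 0 (t + 1) := ⟨ht, by linarith⟩
  have hg : ContDiffOn ℝ 1 (fun z => pd (xDir k) v z * Real.cos (inner ℝ κ z.2)
      + κ k * (v z * Real.sin (inner ℝ κ z.2))) (future n) :=
    (hvk.mul (contDiffOn_inner_snd κ).cos).add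
      (contDiffOn_const.mul (hv1.mul (contDiffOn_inner_snd κ).sin))
  have h := integral_pd_xDir_eq_zero hg (τ := t + 1) (R := R) (fun s hs x hx => by
    simp only [hR s hs x hx, pd_eq_zero_of_support hR hs hx]; simp) htI k
  have hin : inner ℝ κ (xDir k).2 = κ k := by simp [xDir, EuclideanSpace.inner_single_right]
  have e : ∀ x, pd (xDir k) (fun z => pd (xDir k) v z * Real.cos (inner ℝ κ z.2)
      + κ k * (v z * Real.sin (inner ℝ κ z.2))) (t, x) =
      pd (xDir k) (pd (xDir k) v) (t, x) * Real.cos (inner ℝ κ x)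
        + κ k ^ 2 * (v (t, x) * Real.cos (inner ℝ κ x)) := fun x => by
    have hz : ((t, x) : ℝ × EuclideanSpace ℝ (Fin n)) ∈ future n := mem_future.2 ht
    have hvs := hv1.mul (contDiffOn_inner_snd κ).sin
    rw [pd_add (hvk.mul (contDiffOn_inner_snd κ).cos) (contDiffOn_const.mul hvs) hz,
      pd_mul contDiffOn_const hvs hz, pd_mul_cos hvk κ hz, pd_mul_sin hv1 κ hz, hin]
    have : pd (xDir k) (fun _ : ℝ × EuclideanSpace ℝ (Fin n) => κ k) (t, x) = 0 := by simp [pd]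
    rw [this]
    ring
  simp only [e] at h
  rw [integral_add (integrable_cosMode (continuousOn_pd hvk _) ((hs.pd _).pd _) κ ht)
    ((integrable_cosMode hv.continuousOn hs κ ht).const_mul _), integral_const_mul] at h
  unfold cosMode
  linarith

/-- The cosine modes of solutions of the linear equation solve a damped oscillator equation. -/
theorem hasDerivAt_cosMode_pd (hv : ContDiffOn ℝ 2 v (future n)) (hs : HasSliceSupport v)
    (heq : ∀ t, 0 < t → ∀ x,
      waveOp b v (t, x) = n * (deriv b t / b t) * pd (tDir n) v (t, x))
    (κ : EuclideanSpace ℝ (Fin n)) {t : ℝ} (ht : 0 < t) :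
    HasDerivAt (cosMode κ (pd (tDir n) v))
      (n * (deriv b t / b t) * cosMode κ (pd (tDir n) v) t
        - ‖κ‖ ^ 2 * b t ^ 2 * cosMode κ v t) t := by
  have hvt := contDiffOn_pd hv (tDir n)
  refine (hasDerivAt_cosMode hvt (hs.pd _) κ ht).congr_deriv ?_
  have hi1 := integrable_cosMode hvt.continuousOn (hs.pd _) κ ht.le
  have hi2 : ∀ k, Integrable fun x => pd (xDir k) (pd (xDir k) v) (t, x) *
      Real.cos (inner ℝ κ x) := fun k =>
    integrable_cosMode (continuousOn_pd (contDiffOn_pd hv _) _) ((hs.pd _).pd _) κ ht.le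
  have e : ∀ x, pd (tDir n) (pd (tDir n) v) (t, x) * Real.cos (inner ℝ κ x) =
      n * (deriv b t / b t) * (pd (tDir n) v (t, x) * Real.cos (inner ℝ κ x)) +
      b t ^ 2 * ∑ k, pd (xDir k) (pd (xDir k) v) (t, x) * Real.cos (inner ℝ κ x) := fun x => by
    have h := heq t ht x
    simp only [waveOp] at h
    rw [← Finset.sum_mul]
    linear_combination Real.cos (inner ℝ κ x) * h
  have h3 : cosMode κ (pd (tDir n) (pd (tDir n) v)) t =
      n * (deriv b t / b t) * cosMode κ (pd (tDir n) v) t +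
      b t ^ 2 * ∑ k, cosMode κ (pd (xDir k) (pd (xDir k) v)) t := by
    simp only [cosMode, e]
    rw [integral_add (hi1.const_mul _) ((integrable_finsetSum _ fun k _ => hi2 k).const_mul _),
      integral_const_mul, integral_const_mul, integral_finsetSum _ fun k _ => hi2 k]
  rw [h3]
  simp only [cosMode_pd_pd hv hs κ ht.le, Finset.sum_neg_distrib, ← Finset.sum_mul]
  rw [EuclideanSpace.real_norm_sq_eq]
  ring

/-! ### Polynomial bounds for solutions bounded on one side -/

theorem abs_sub_le_of_deriv_bound {g g' : ℝ → ℝ} {K : ℝ} (hg : ContinuousOn g (Ici 0))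
    (hd : ∀ t, 0 < t → HasDerivAt g (g' t) t) (hK : ∀ t, 0 < t → |g' t| ≤ K) {t : ℝ}
    (ht : 0 ≤ t) : |g t - g 0| ≤ K * t := by
  rcases ht.eq_or_lt with rfl | ht
  · simp
  obtain ⟨s, hs, he⟩ := exists_hasDerivAt_eq_slope g g' ht (hg.mono Icc_subset_Ici_self)
    fun s hs => hd s hs.1
  have h := hK s hs.1
  rw [he, sub_zero, abs_div, abs_of_pos ht, div_le_iff₀ ht] at h
  exact h

/-- On `A` the bound `g ≤ C` with `C ≥ 0` gives `|g| ≤ 2 C - g`; off `A` both sides are zero once `2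
C` is replaced by its indicator. -/
theorem integral_abs_le_of_le {E : Type*} [MeasureSpace E] {g : E → ℝ} {A : Set E}
    (hA : MeasurableSet A) (hA' : volume A ≠ ⊤) (hg : Integrable g) {C : ℝ} (hC : 0 ≤ C)
    (hgC : ∀ x, g x ≤ C) (hg0 : ∀ x, x ∉ A → g x = 0) :
    ∫ x, |g x| ≤ 2 * C * volume.real A + |∫ x, g x| := by
  have hi : Integrable (A.indicator fun _ => 2 * C) :=
    (integrable_indicator_iff hA).2 (integrableOn_const hA')
  have h1 : ∫ x, |g x| ≤ ∫ x, (A.indicator (fun _ => 2 * C) x - g x) := by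
    refine integral_mono hg.abs (hi.sub hg) fun x => ?_
    by_cases hx : x ∈ A
    · simp only [indicator_of_mem hx]
      exact abs_le.2 ⟨by linarith [hgC x], by linarith [hgC x]⟩
    · simp [hg0 x hx, indicator_of_notMem hx]
  rw [integral_sub hi hg, integral_indicator hA, setIntegral_const, smul_eq_mul] at h1
  linarith [neg_abs_le (∫ x, g x)]

/-- A one-sided bound alone does not control the `L¹` norm; the mode of frequency `0`, which grows
at most linearly, supplies the other side. -/
theorem cosMode_growth (hv : ContDiffOn ℝ 2 v (future n)) {R β : ℝ} (hR : 0 ≤ R) (hβ : 0 ≤ β)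
    (hb : ContDiff ℝ 1 b) (hb0 : ∀ t, 0 < b t) (hbβ : ∀ t, b t ≤ β)
    (hsupp : ∀ t, 0 ≤ t → ∀ x, R + (β * t + 2) ≤ ‖x‖ → v (t, x) = 0) (hs : HasSliceSupport v)
    (heq : ∀ t, 0 < t → ∀ x,
      waveOp b v (t, x) = n * (deriv b t / b t) * pd (tDir n) v (t, x))
    (hbdd : ∃ C, (∀ z ∈ future n, v z ≤ C) ∨ (∀ z ∈ future n, -v z ≤ C))
    (κ : EuclideanSpace ℝ (Fin n)) : HasPolynomialGrowth (cosMode κ v) := by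
  have hv1 : ContDiffOn ℝ 1 v (future n) := hv.of_le (by norm_num)
  have hvt := contDiffOn_pd hv (tDir n)
  -- the mean
  set mean := cosMode (0 : EuclideanSpace ℝ (Fin n)) v with hmean
  set mean' := cosMode (0 : EuclideanSpace ℝ (Fin n)) (pd (tDir n) v)
  have hm' : ∀ t, 0 < t → HasDerivAt mean' (n * (deriv b t / b t) * mean' t) t := fun t ht => by
    simpa using hasDerivAt_cosMode_pd hv hs heq 0 ht
  have hm'c : ContinuousOn mean' (Ici 0) := continuousOn_cosMode hvt.continuousOn (hs.pd _) 0
  -- At frequency `0` the oscillator equation reduces to `m'' = n (b'/b) m'`, with first integral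
  -- `m' / b^n`.
  have hquot : ∀ t, 0 ≤ t → mean' t / b t ^ n = mean' 0 / b 0 ^ n := fun t ht => by
    have h := abs_sub_le_of_deriv_bound (g := fun t => mean' t / b t ^ n) (g' := fun _ => 0)
      (K := 0) (hm'c.div (hb.continuous.pow n).continuousOn fun s _ => (pow_pos (hb0 s) n).ne')
      (fun s hs => ?_) (by simp) ht
    · rw [zero_mul] at h
      exact sub_eq_zero.1 (abs_eq_zero.1 (le_antisymm h (abs_nonneg _)))
    · have hbs : b s ≠ 0 := (hb0 s).ne'
      refine ((hm' s hs).fun_div (((hb.differentiable (by norm_num)) s).hasDerivAt.fun_pow n)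
        (pow_pos (hb0 s) n).ne').congr_deriv ?_
      rcases Nat.eq_zero_or_pos n with h0 | h0
      · simp [h0]
      · obtain ⟨k, hk⟩ := Nat.exists_eq_succ_of_ne_zero h0.ne'
        simp only [hk, Nat.succ_eq_add_one, Nat.add_sub_cancel, pow_succ]
        field_simp
        ring
  set K := |mean' 0 / b 0 ^ n| * β ^ n
  have hm'K : ∀ t, 0 < t → |mean' t| ≤ K := fun t ht => by
    have h : mean' t = mean' 0 / b 0 ^ n * b t ^ n := by
      rw [← hquot t ht.le, div_mul_cancel₀ _ (pow_pos (hb0 t) n).ne']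
    rw [h, abs_mul, abs_of_pos (pow_pos (hb0 t) n)]
    exact mul_le_mul_of_nonneg_left (pow_le_pow_left₀ (hb0 t).le (hbβ t) n) (abs_nonneg _)
  have hmK : ∀ t, 0 ≤ t → |mean t| ≤ |mean 0| + K * t := fun t ht => by
    have h := abs_sub_le_of_deriv_bound (continuousOn_cosMode hv.continuousOn hs 0)
      (fun s hs' => hasDerivAt_cosMode hv1 hs 0 hs') hm'K ht
    have := abs_sub_abs_le_abs_sub (mean t) (mean 0)
    linarith
  -- the absolute integral
  obtain ⟨C, hC⟩ := hbdd
  set C' := max C 0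
  have hslice : ∀ t, 0 ≤ t → Integrable fun x => v (t, x) := fun t ht => by
    simpa using integrable_cosMode hv.continuousOn hs 0 ht
  have hmeq : ∀ t, ∫ x, v (t, x) = mean t := fun t => by simp [hmean, cosMode]
  have habs : ∀ t, 0 ≤ t → ∫ x, |v (t, x)| ≤
      2 * C' * volume.real (Metric.closedBall (0 : EuclideanSpace ℝ (Fin n)) (R + (β * t + 2)))
        + |mean t| := by
    intro t ht
    have hfin : volume (Metric.closedBall (0 : EuclideanSpace ℝ (Fin n)) (R + (β * t + 2))) ≠ ⊤ :=
      (isCompact_closedBall _ _).measure_lt_top.ne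
    have hout : ∀ x, x ∉ Metric.closedBall (0 : EuclideanSpace ℝ (Fin n)) (R + (β * t + 2)) →
        v (t, x) = 0 := fun x hx => hsupp t ht x (by
      rw [Metric.mem_closedBall, dist_zero_right, not_le] at hx; exact hx.le)
    rw [← hmeq t]
    rcases hC with hC | hC
    · exact integral_abs_le_of_le measurableSet_closedBall hfin (hslice t ht) (le_max_right _ _)
        (fun x => (hC (t, x) (mem_future.2 ht)).trans (le_max_left _ _)) hout
    · have := integral_abs_le_of_le measurableSet_closedBall hfin (hslice t ht).neg
        (le_max_right C 0) (fun x => (hC (t, x) (mem_future.2 ht)).trans (le_max_left _ _))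
        (fun x hx => by simp [hout x hx])
      simpa [integral_neg] using this
  set B := volume.real (Metric.ball (0 : EuclideanSpace ℝ (Fin n)) 1)
  -- The ball has volume of order `t^n` and the mean is of order `t`; the exponent `n + 1` dominates
  -- both.
  refine ⟨2 * C' * ((R + β + 2) ^ n * B) + (|mean 0| + K), n + 1, fun t ht => ?_⟩
  have h1 : |cosMode κ v t| ≤ ∫ x, |v (t, x)| := by
    refine (abs_integral_le_integral_abs).trans ?_
    refine integral_mono (integrable_cosMode hv.continuousOn hs κ ht).abs (hslice t ht).abs
      fun x => ?_
    simp only [abs_mul]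
    exact mul_le_of_le_one_right (abs_nonneg _) (Real.abs_cos_le_one _)
  have hρ : 0 ≤ R + (β * t + 2) := by positivity
  have h2 : volume.real (Metric.closedBall (0 : EuclideanSpace ℝ (Fin n)) (R + (β * t + 2))) =
      (R + (β * t + 2)) ^ n * B := by
    rw [Measure.real, Measure.addHaar_closedBall _ _ hρ, ENNReal.toReal_mul,
      ENNReal.toReal_ofReal (by positivity), finrank_euclideanSpace_fin]
    rfl
  have hB : 0 ≤ B := measureReal_nonneg
  have hC0 : 0 ≤ C' := le_max_right _ _
  have hK0 : 0 ≤ K := by positivity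
  have h3 : R + (β * t + 2) ≤ (R + β + 2) * (1 + t) := by nlinarith [mul_nonneg hR ht]
  have h4 : (R + (β * t + 2)) ^ n ≤ (R + β + 2) ^ n * (1 + t) ^ (n + 1) := by
    calc (R + (β * t + 2)) ^ n ≤ ((R + β + 2) * (1 + t)) ^ n := by gcongr
      _ = (R + β + 2) ^ n * (1 + t) ^ n := mul_pow _ _ _
      _ ≤ _ := by
        exact mul_le_mul_of_nonneg_left
          (pow_le_pow_right₀ (show (1 : ℝ) ≤ 1 + t by linarith) (Nat.le_succ n)) (by positivity)
  have h5 : 1 + t ≤ (1 + t) ^ (n + 1) := by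
    simpa using pow_le_pow_right₀ (show (1 : ℝ) ≤ 1 + t by linarith) (Nat.le_add_left 1 n)
  have h6 : |mean 0| + K * t ≤ (|mean 0| + K) * (1 + t) ^ (n + 1) := by
    have : |mean 0| + K * t ≤ (|mean 0| + K) * (1 + t) := by
      nlinarith [abs_nonneg (mean 0), mul_nonneg (abs_nonneg (mean 0)) ht]
    refine this.trans ?_
    gcongr
  have h7 := habs t ht
  rw [h2] at h7
  have h8 : 2 * C' * ((R + (β * t + 2)) ^ n * B) ≤
      2 * C' * ((R + β + 2) ^ n * (1 + t) ^ (n + 1) * B) := by gcongr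
  calc |cosMode κ v t| ≤ 2 * C' * ((R + (β * t + 2)) ^ n * B) + |mean t| := h1.trans h7
    _ ≤ 2 * C' * ((R + β + 2) ^ n * (1 + t) ^ (n + 1) * B) +
        (|mean 0| + K) * (1 + t) ^ (n + 1) := by linarith [hmK t ht]
    _ = _ := by ring

end

/-! ### Sobolev norms of test functions -/

section

variable {n : ℕ}

theorem sobolevNorm_const_mul (s r : ℝ) (φ : EuclideanSpace ℝ (Fin n) → ℝ) :
    sobolevNorm s (fun x => r * φ x) = ENNReal.ofReal |r| * sobolevNorm s φ := by
  have h1 : ∀ ξ, 𝓕 (fun x => ((r * φ x : ℝ) : ℂ)) ξ = (r : ℂ) * 𝓕 (fun x => (φ x : ℂ)) ξ := by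
    intro ξ
    simp only [Real.fourier_eq, Circle.smul_def, smul_eq_mul, Complex.ofReal_mul]
    rw [← integral_const_mul]
    congr 1
    ext x
    ring
  have h2 : ∀ ξ : EuclideanSpace ℝ (Fin n), ENNReal.ofReal ((1 + (2 * Real.pi * ‖ξ‖) ^ 2) ^ s *
      ‖𝓕 (fun x => ((r * φ x : ℝ) : ℂ)) ξ‖ ^ 2) = ENNReal.ofReal (|r| ^ 2) *
      ENNReal.ofReal ((1 + (2 * Real.pi * ‖ξ‖) ^ 2) ^ s * ‖𝓕 (fun x => (φ x : ℂ)) ξ‖ ^ 2) := by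
    intro ξ
    rw [← ENNReal.ofReal_mul (by positivity), h1, norm_mul, Complex.norm_real, Real.norm_eq_abs]
    congr 1
    ring
  simp only [sobolevNorm, h2]
  rw [lintegral_const_mul' _ _ ENNReal.ofReal_ne_top, ENNReal.mul_rpow_of_nonneg _ _ (by norm_num),
    ENNReal.ofReal_rpow_of_nonneg (by positivity) (by norm_num), ← Real.sqrt_eq_rpow,
    Real.sqrt_sq (abs_nonneg r)]

/-- The Fourier transform of a test function is Schwartz. With `N ≥ |s|` and decay of order `N + n +
1`, the squared transform absorbs the weight and leaves `(1 + |ξ|)^(-2(n+1))`, which is integrable.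
-/
theorem sobolevNorm_lt_top (s : ℝ) {φ : EuclideanSpace ℝ (Fin n) → ℝ} (hφ : ContDiff ℝ ∞ φ)
    (hφc : HasCompactSupport φ) : sobolevNorm s φ < ⊤ := by
  have hc : HasCompactSupport (fun x => (φ x : ℂ)) := hφc.comp_left Complex.ofReal_zero
  set Φ := hc.toSchwartzMap (Complex.ofRealCLM.contDiff.comp hφ) with hΦ
  set N : ℕ := ⌈|s|⌉₊ with hN
  set k : ℕ := N + n + 1 with hk
  obtain ⟨C, hC⟩ : ∃ C : ℝ, ∀ ξ, (1 + ‖ξ‖) ^ k * ‖𝓕 (fun x => (φ x : ℂ)) ξ‖ ≤ C := by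
    refine ⟨2 ^ k * (Finset.Iic (k, 0)).sup (fun m => SchwartzMap.seminorm ℝ m.1 m.2) (𝓕 Φ),
      fun ξ => ?_⟩
    have h := SchwartzMap.one_add_le_sup_seminorm_apply (𝕜 := ℝ) (m := (k, 0)) le_rfl le_rfl (𝓕 Φ) ξ
    rw [norm_iteratedFDeriv_zero] at h
    exact h
  refine ENNReal.rpow_lt_top_of_nonneg (by norm_num) (ne_of_lt ?_)
  set A : ℝ := ((2 * Real.pi) ^ 2) ^ N * C ^ 2
  have hpt : ∀ ξ : EuclideanSpace ℝ (Fin n), (1 + (2 * Real.pi * ‖ξ‖) ^ 2) ^ s *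
      ‖𝓕 (fun x => (φ x : ℂ)) ξ‖ ^ 2 ≤ A * (1 + ‖ξ‖) ^ (-(2 * (n + 1) : ℝ)) := by
    intro ξ
    have hpi : 1 ≤ 2 * Real.pi := by linarith [Real.pi_gt_three]
    have h1 : (1 + (2 * Real.pi * ‖ξ‖) ^ 2) ^ s ≤ ((2 * Real.pi) ^ 2) ^ N * ((1 + ‖ξ‖) ^ 2) ^ N := by
      have hone : 1 ≤ 1 + (2 * Real.pi * ‖ξ‖) ^ 2 := by
        have := sq_nonneg (2 * Real.pi * ‖ξ‖); linarith
      calc (1 + (2 * Real.pi * ‖ξ‖) ^ 2) ^ s ≤ (1 + (2 * Real.pi * ‖ξ‖) ^ 2) ^ (N : ℝ) :=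
            Real.rpow_le_rpow_of_exponent_le hone ((le_abs_self s).trans (Nat.le_ceil _))
        _ = (1 + (2 * Real.pi * ‖ξ‖) ^ 2) ^ N := Real.rpow_natCast _ _
        _ ≤ ((2 * Real.pi) ^ 2 * (1 + ‖ξ‖) ^ 2) ^ N := by
            refine pow_le_pow_left₀ (by positivity) ?_ N
            have : 1 ≤ (2 * Real.pi) ^ 2 := one_le_pow₀ hpi
            nlinarith [norm_nonneg ξ, mul_nonneg (sq_nonneg (2 * Real.pi)) (norm_nonneg ξ)]
        _ = _ := mul_pow _ _ _
    have h2 : ((1 + ‖ξ‖) ^ k * ‖𝓕 (fun x => (φ x : ℂ)) ξ‖) ^ 2 ≤ C ^ 2 :=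
      pow_le_pow_left₀ (by positivity) (hC ξ) 2
    have hq : 0 < 1 + ‖ξ‖ := by positivity
    have h3 : (1 + ‖ξ‖) ^ (-(2 * (n + 1) : ℝ)) = ((1 + ‖ξ‖) ^ (2 * (n + 1)))⁻¹ := by
      rw [Real.rpow_neg hq.le, ← Real.rpow_natCast]
      push_cast
      rfl
    rw [h3, ← div_eq_mul_inv, le_div_iff₀ (by positivity)]
    calc (1 + (2 * Real.pi * ‖ξ‖) ^ 2) ^ s * ‖𝓕 (fun x => (φ x : ℂ)) ξ‖ ^ 2
          * (1 + ‖ξ‖) ^ (2 * (n + 1))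
        ≤ ((2 * Real.pi) ^ 2) ^ N * ((1 + ‖ξ‖) ^ 2) ^ N * ‖𝓕 (fun x => (φ x : ℂ)) ξ‖ ^ 2
          * (1 + ‖ξ‖) ^ (2 * (n + 1)) := by gcongr
      _ = ((2 * Real.pi) ^ 2) ^ N * ((1 + ‖ξ‖) ^ k * ‖𝓕 (fun x => (φ x : ℂ)) ξ‖) ^ 2 := by
          rw [hk]; generalize 1 + ‖ξ‖ = q; ring
      _ ≤ A := mul_le_mul_of_nonneg_left h2 (by positivity)
  calc ∫⁻ ξ : EuclideanSpace ℝ (Fin n), ENNReal.ofReal ((1 + (2 * Real.pi * ‖ξ‖) ^ 2) ^ s *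
      ‖𝓕 (fun x => (φ x : ℂ)) ξ‖ ^ 2)
      ≤ ∫⁻ ξ : EuclideanSpace ℝ (Fin n), ENNReal.ofReal A *
          ENNReal.ofReal ((1 + ‖ξ‖) ^ (-(2 * (n + 1) : ℝ))) := by
        refine lintegral_mono fun ξ => ?_
        rw [← ENNReal.ofReal_mul (by positivity)]
        exact ENNReal.ofReal_le_ofReal (hpt ξ)
    _ = ENNReal.ofReal A * ∫⁻ ξ : EuclideanSpace ℝ (Fin n),
          ENNReal.ofReal ((1 + ‖ξ‖) ^ (-(2 * (n + 1) : ℝ))) :=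
        lintegral_const_mul' _ _ ENNReal.ofReal_ne_top
    _ < ⊤ := by
        refine ENNReal.mul_lt_top ENNReal.ofReal_lt_top (finite_integral_one_add_norm ?_)
        rw [finrank_euclideanSpace_fin]
        linarith [(n.cast_nonneg : (0 : ℝ) ≤ n)]

/-! ### Bounds for the scale function -/

theorem exists_bounds_of_periodic {b : ℝ → ℝ} {T : ℝ} (hT : 0 < T) (hper : Function.Periodic b T)
    (hb : Continuous b) (hb0 : ∀ t, 0 < b t) :
    ∃ c β : ℝ, 0 < c ∧ (∀ t, c ≤ b t) ∧ ∀ t, b t ≤ β := by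
  have hne : (Icc 0 T).Nonempty := ⟨0, le_rfl, hT.le⟩
  obtain ⟨p, -, hp⟩ := isCompact_Icc.exists_isMinOn hne hb.continuousOn
  obtain ⟨q, -, hq⟩ := isCompact_Icc.exists_isMaxOn hne hb.continuousOn
  refine ⟨b p, b q, hb0 p, fun t => ?_, fun t => ?_⟩
  · obtain ⟨y, hy, e⟩ := hper.exists_mem_Ico₀ hT t
    rw [e]
    exact hp (Ico_subset_Icc_self hy)
  · obtain ⟨y, hy, e⟩ := hper.exists_mem_Ico₀ hT t
    rw [e]
    exact hq (Ico_subset_Icc_self hy)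

/-! ### Contradiction with parametric resonance -/

/-- On the support `|κ·x| ≤ 1 < π/2`, so the cosine is nonnegative, and the integrand is positive at
the origin. -/
theorem integral_mul_cos_pos {g : EuclideanSpace ℝ (Fin n) → ℝ} (hg : Continuous g)
    (hg0 : ∀ x, 0 ≤ g x) (hpos : 0 < g 0) {κ : EuclideanSpace ℝ (Fin n)} {R : ℝ}
    (hR : ‖κ‖ * R ≤ 1) (hsupp : ∀ x, R ≤ ‖x‖ → g x = 0) :
    0 < ∫ x, g x * Real.cos (inner ℝ κ x) := by
  refine Continuous.integral_pos_of_hasCompactSupport_nonneg_nonzero (x := 0)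
    (hg.mul (Real.continuous_cos.comp (by fun_prop))) ?_ (fun x => ?_) (by simpa using hpos.ne')
  · refine HasCompactSupport.intro (isCompact_closedBall 0 R) fun x hx => ?_
    rw [Metric.mem_closedBall, dist_zero_right, not_le] at hx
    simp [hsupp x hx.le]
  · rcases le_or_gt R ‖x‖ with hx | hx
    · simp [hsupp x hx]
    · refine mul_nonneg (hg0 x) (Real.cos_nonneg_of_mem_Icc (abs_le.1 ?_))
      have h1 := abs_real_inner_le_norm κ x
      have h2 : ‖κ‖ * ‖x‖ ≤ ‖κ‖ * R := by gcongr
      linarith [Real.pi_gt_three]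

variable {b : ℝ → ℝ}

/-- The cosine modes of a solution of the linear equation that is bounded on one side, divided by
`b^(n/2)`, are solutions of Hill's equation of polynomial growth. -/
theorem hill_of_linear (hb : ContDiff ℝ 2 b) {c β : ℝ} (hc : 0 < c) (hbc : ∀ t, c ≤ b t)
    (hbβ : ∀ t, b t ≤ β) {R : ℝ} (hR : 0 ≤ R)
    {v : ℝ × EuclideanSpace ℝ (Fin n) → ℝ} (hv : ContDiffOn ℝ 2 v (future n))
    (heq : ∀ t, 0 < t → ∀ x,
      waveOp b v (t, x) = n * (deriv b t / b t) * pd (tDir n) v (t, x))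
    (hsupp : ∀ t, 0 ≤ t → ∀ x, R + (β * t + 2) ≤ ‖x‖ → v (t, x) = 0)
    (hbdd : ∃ C, (∀ z ∈ future n, v z ≤ C) ∨ (∀ z ∈ future n, -v z ≤ C))
    (κ : EuclideanSpace ℝ (Fin n)) :
    IsHalfLineSolution (fun t => ‖κ‖ ^ 2 * b t ^ 2 - potential b n t)
      (fun t => b t ^ (-(n / 2 : ℝ)) * cosMode κ v t)
      (fun t => b t ^ (-(n / 2 : ℝ)) *
        (cosMode κ (pd (tDir n) v) t - n / 2 * (deriv b t / b t) * cosMode κ v t)) ∧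
    HasPolynomialGrowth (fun t => b t ^ (-(n / 2 : ℝ)) * cosMode κ v t) := by
  have hb0 : ∀ t, 0 < b t := fun t => hc.trans_le (hbc t)
  have hβ : 0 ≤ β := (hb0 0).le.trans (hbβ 0)
  have hs : HasSliceSupport v := fun τ => ⟨R + (β * τ + 2), fun t ht x hx =>
    hsupp t ht.1 x (by have := mul_le_mul_of_nonneg_left ht.2.le hβ; linarith)⟩
  have hv1 : ContDiffOn ℝ 1 v (future n) := hv.of_le (by norm_num)
  refine ⟨isHalfLineSolution_of_damped hb hb0 (continuousOn_cosMode hv.continuousOn hs κ)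
    (continuousOn_cosMode (contDiffOn_pd hv _).continuousOn (hs.pd _) κ)
    (fun t ht => hasDerivAt_cosMode hv1 hs κ ht)
    (fun t ht => hasDerivAt_cosMode_pd hv hs heq κ ht), ?_⟩
  obtain ⟨K, N, hK⟩ := cosMode_growth hv hR hβ (hb.of_le (by norm_num)) hb0 hbβ hsupp hs heq hbdd κ
  refine ⟨c ^ (-(n / 2 : ℝ)) * K, N, fun t ht => ?_⟩
  rw [abs_mul, abs_of_pos (Real.rpow_pos_of_pos (hb0 t) _), mul_assoc]
  have h1 : b t ^ (-(n / 2 : ℝ)) ≤ c ^ (-(n / 2 : ℝ)) :=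
    Real.rpow_le_rpow_of_nonpos hc (hbc t) (by
      have : (0 : ℝ) ≤ n / 2 := by positivity
      linarith)
  have h2 : 0 ≤ c ^ (-(n / 2 : ℝ)) := (Real.rpow_pos_of_pos hc _).le
  exact mul_le_mul h1 (hK t ht) (abs_nonneg _) h2

/-- For an unstable frequency, one of the two families of data on a distinguished line, pure
velocity or pure position, does not admit global wave maps, however small the amplitude is. -/
theorem not_exists_isGlobalSolution (hn : 1 ≤ n) {m : ℕ} {T : ℝ} (hT : 0 < T)
    (hper : Function.Periodic b T) (hb : ContDiff ℝ 2 b) {c β : ℝ} (hc : 0 < c)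
    (hbc : ∀ t, c ≤ b t) (hbβ : ∀ t, b t ≤ β) {κ : EuclideanSpace ℝ (Fin n)}
    (hunst : IsUnstable b n T (‖κ‖ ^ 2)) {M : RiemannianChart m} {a : Fin m → ℝ} {f : ℝ → ℝ}
    (h_line : M.IsDistinguishedLine a f) (h_viol : M.ViolatesNakanishiOhta a f)
    {ψ : EuclideanSpace ℝ (Fin n) → ℝ} (hψ : Continuous ψ) (hψ0 : ∀ x, 0 ≤ ψ x) (hψ1 : 0 < ψ 0)
    {R : ℝ} (hR0 : 0 ≤ R) (hR : ‖κ‖ * R ≤ 1) (hsupp : ∀ x, R ≤ ‖x‖ → ψ x = 0) :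
    (∀ ε : ℝ, 0 < ε → ¬ ∃ u, IsGlobalSolution b M (fun i x => (0 : ℝ) * ψ x * a i)
      (fun i x => ε * ψ x * a i) u) ∨
    (∀ ε : ℝ, 0 < ε → ¬ ∃ u, IsGlobalSolution b M (fun i x => ε * ψ x * a i)
      (fun i x => (0 : ℝ) * ψ x * a i) u) := by
  have hb0 : ∀ t, 0 < b t := fun t => hc.trans_le (hbc t)
  have hB : b 0 ^ (-(n / 2 : ℝ)) ≠ 0 := (Real.rpow_pos_of_pos (hb0 0) _).ne'
  have hfar : ∀ (r : ℝ) x, R ≤ ‖x‖ → r * ψ x = 0 := fun r x hx => by rw [hsupp x hx, mul_zero]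
  -- The slope `-(n/2) b'(0)/b(0)` is that of `b^(-n/2) c` when `c'(0) = 0`, i.e. for pure position
  -- data. Pure velocity data give a Hill solution vanishing at `0`.
  rcases hunst.growth hT hb (fun t => (hb0 t).ne') hper (-(n / 2 * (deriv b 0 / b 0))) with h | h
  · left
    rintro ε hε ⟨u, hu⟩
    obtain ⟨v, hv, heq, hvs, hbdd, hv0, -, hvt⟩ := hu.exists_linear (θ₀ := fun x => 0 * ψ x)
      (θ₁ := fun x => ε * ψ x) hn hb hc hbc hbβ h_line h_viol (hfar 0) (hfar ε)
    obtain ⟨hY, hgrow⟩ := hill_of_linear hb hc hbc hbβ hR0 hv heq hvs hbdd κ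
    have e0 : cosMode κ v 0 = 0 := by simp [cosMode, hv0, linearizer]
    have e1 : 0 < cosMode κ (pd (tDir n) v) 0 := by
      simp only [cosMode, hvt, zero_mul, intervalIntegral.integral_same, Real.exp_zero, one_mul]
      exact integral_mul_cos_pos (by fun_prop) (fun x => mul_nonneg hε.le (hψ0 x))
        (mul_pos hε hψ1) hR (hfar ε)
    refine h _ _ hY (by simp [e0]) ?_ hgrow
    simp only [e0, mul_zero, sub_zero]
    exact mul_ne_zero hB e1.ne'
  · right
    rintro ε hε ⟨u, hu⟩
    obtain ⟨v, hv, heq, hvs, hbdd, hv0, hpos, hvt⟩ := hu.exists_linear (θ₀ := fun x => ε * ψ x)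
      (θ₁ := fun x => 0 * ψ x) hn hb hc hbc hbβ h_line h_viol (hfar ε) (hfar 0)
    obtain ⟨hY, hgrow⟩ := hill_of_linear hb hc hbc hbβ hR0 hv heq hvs hbdd κ
    have e1 : cosMode κ (pd (tDir n) v) 0 = 0 := by simp [cosMode, hvt]
    have hlin0 : linearizer f 0 = 0 := by simp [linearizer]
    -- The initial value of `v` is `F(ε ψ)`, not `ε ψ`; it has the same sign and the same zeros, so
    -- positivity of the mode survives.
    have e0 : 0 < cosMode κ v 0 := by
      refine integral_mul_cos_pos (g := fun x => v (0, x))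
        (continuous_slice hv.continuousOn le_rfl) (fun x => ?_) ?_ hR fun x hx => ?_
      · rw [hv0]
        rcases (hψ0 x).eq_or_lt with hx | hx
        · rw [← hx, mul_zero, hlin0]
        · exact (hpos x (mul_pos hε hx)).le
      · rw [hv0]
        exact hpos 0 (mul_pos hε hψ1)
      · rw [hv0, hfar ε x hx, hlin0]
    refine h _ _ hY (mul_ne_zero hB e0.ne') ?_ hgrow
    simp only [e1]
    ring

end

end WaveMap

/-! ### The main theorem: frequency, bump function and amplitude -/

open WaveMap

theorem mainTheorem1 (n m : ℕ) (hn : 1 ≤ n)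
    (b : ℝ → ℝ) (T : ℝ) (hT : 0 < T) (hb_per : Function.Periodic b T)
    (hb_smooth : ContDiff ℝ ∞ b) (hb_pos : ∀ t, 0 < b t) (hb_nonconst : ¬ ∃ c, ∀ t, b t = c)
    (hb_instab : WaveMap.HasInstabilityInterval b n T)
    (M : WaveMap.RiemannianChart m) (a : Fin m → ℝ) (f : ℝ → ℝ)
    (h_line : M.IsDistinguishedLine a f) (h_viol : M.ViolatesNakanishiOhta a f)
    (s δ : ℝ) (hδ : 0 < δ) :
    ∃ u₀ u₁ : Fin m → EuclideanSpace ℝ (Fin n) → ℝ,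
      (∀ i, ContDiff ℝ ∞ (u₀ i) ∧ HasCompactSupport (u₀ i)) ∧
      (∀ i, ContDiff ℝ ∞ (u₁ i) ∧ HasCompactSupport (u₁ i)) ∧
      (∀ x, (fun l => u₀ l x) ∈ M.domain) ∧
      ∑ i, (WaveMap.sobolevNorm (s + 1) (u₀ i) + WaveMap.sobolevNorm s (u₁ i))
        ≤ ENNReal.ofReal δ ∧
      ¬ ∃ u : Fin m → ℝ → EuclideanSpace ℝ (Fin n) → ℝ,
        WaveMap.IsGlobalSolution b M u₀ u₁ u := by
  have hb2 : ContDiff ℝ 2 b := hb_smooth.of_le (by norm_cast)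
  obtain ⟨c, β, hc, hbc, hbβ⟩ := exists_bounds_of_periodic hT hb_per hb2.continuous hb_pos
  obtain ⟨Lam, -, ⟨lam, hlam⟩, -, hLam0, hLam⟩ := hb_instab
  have hlam0 : 0 < lam := hLam0 hlam
  set κ : EuclideanSpace ℝ (Fin n) := EuclideanSpace.single ⟨0, hn⟩ (√lam) with hκ
  have hκlam : ‖κ‖ ^ 2 = lam := by
    rw [hκ, PiLp.norm_single, Real.norm_eq_abs, sq_abs, Real.sq_sqrt hlam0.le]
  have hunst : IsUnstable b n T (‖κ‖ ^ 2) := by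
    rw [hκlam]
    exact hLam lam hlam
  -- the bump function
  have hR : 0 < (1 + ‖κ‖)⁻¹ := by positivity
  -- The outer radius `1 / (1 + |κ|)` ensures `|κ| R ≤ 1`.
  let ψ : ContDiffBump (0 : EuclideanSpace ℝ (Fin n)) :=
    ⟨(1 + ‖κ‖)⁻¹ / 2, (1 + ‖κ‖)⁻¹, by positivity, by linarith⟩
  have hψs : ContDiff ℝ ∞ ψ := ψ.contDiff
  have hψc : HasCompactSupport ψ := ψ.hasCompactSupport
  have hκR : ‖κ‖ * (1 + ‖κ‖)⁻¹ ≤ 1 := by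
    rw [← div_eq_mul_inv, div_le_one (by positivity)]
    linarith
  -- the amplitude
  set A := ∑ i, (ENNReal.ofReal |a i| * sobolevNorm (s + 1) ψ +
    ENNReal.ofReal |a i| * sobolevNorm s ψ) with hA
  have hAtop : A < ⊤ := ENNReal.sum_lt_top.2 fun i _ => ENNReal.add_lt_top.2
    ⟨ENNReal.mul_lt_top ENNReal.ofReal_lt_top (sobolevNorm_lt_top _ hψs hψc),
      ENNReal.mul_lt_top ENNReal.ofReal_lt_top (sobolevNorm_lt_top _ hψs hψc)⟩
  obtain ⟨ρ, hρ, hball⟩ := Metric.isOpen_iff.1 M.isOpen_domain 0 h_line.zero_mem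
  -- One condition makes the Sobolev norms at most `δ`, the other keeps the data in a ball around
  -- `0` inside the chart. The `+ 1` in the denominators avoids division by zero.
  obtain ⟨ε, hε, hε1, hε2⟩ : ∃ ε : ℝ, 0 < ε ∧ ε * A.toReal ≤ δ ∧ ε * ‖a‖ < ρ := by
    have h1 : 0 ≤ A.toReal := ENNReal.toReal_nonneg
    have h2 : 0 ≤ ‖a‖ := norm_nonneg a
    refine ⟨min (δ / (A.toReal + 1)) (ρ / (‖a‖ + 1)), by positivity, ?_, ?_⟩
    · calc min (δ / (A.toReal + 1)) (ρ / (‖a‖ + 1)) * A.toReal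
          ≤ δ / (A.toReal + 1) * A.toReal := by gcongr; exact min_le_left _ _
        _ ≤ δ := by
          rw [div_mul_eq_mul_div, div_le_iff₀ (by positivity)]
          nlinarith
    · calc min (δ / (A.toReal + 1)) (ρ / (‖a‖ + 1)) * ‖a‖
          ≤ ρ / (‖a‖ + 1) * ‖a‖ := by gcongr; exact min_le_right _ _
        _ < ρ := by
          rw [div_mul_eq_mul_div, div_lt_iff₀ (by positivity)]
          nlinarith
  -- Smallness and regularity are checked for both families together, as `(r₀, r₁)` will be `(0, ε)`
  -- or `(ε, 0)`.
  have key : ∀ r₀ r₁ : ℝ, |r₀| ≤ ε → |r₁| ≤ ε →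
      (¬ ∃ u, IsGlobalSolution b M (fun i x => r₀ * ψ x * a i) (fun i x => r₁ * ψ x * a i) u) →
      ∃ u₀ u₁ : Fin m → EuclideanSpace ℝ (Fin n) → ℝ,
        (∀ i, ContDiff ℝ ∞ (u₀ i) ∧ HasCompactSupport (u₀ i)) ∧
        (∀ i, ContDiff ℝ ∞ (u₁ i) ∧ HasCompactSupport (u₁ i)) ∧
        (∀ x, (fun l => u₀ l x) ∈ M.domain) ∧
        ∑ i, (sobolevNorm (s + 1) (u₀ i) + sobolevNorm s (u₁ i)) ≤ ENNReal.ofReal δ ∧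
        ¬ ∃ u, IsGlobalSolution b M u₀ u₁ u := by
    intro r₀ r₁ h₀ h₁ hno
    have hreg : ∀ (r : ℝ) (i : Fin m), ContDiff ℝ ∞ (fun x => r * ψ x * a i) ∧
        HasCompactSupport (fun x => r * ψ x * a i) := fun r i =>
      ⟨(contDiff_const.mul hψs).mul contDiff_const, (hψc.mul_left).mul_right⟩
    have hsob : ∀ (σ r : ℝ), |r| ≤ ε → ∀ i, sobolevNorm σ (fun x => r * ψ x * a i) ≤
        ENNReal.ofReal ε * (ENNReal.ofReal |a i| * sobolevNorm σ ψ) := fun σ r hr i => by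
      have e : (fun x => r * ψ x * a i) = fun x => (r * a i) * ψ x := by ext x; ring
      rw [e, sobolevNorm_const_mul, abs_mul, ENNReal.ofReal_mul (abs_nonneg r), mul_assoc]
      gcongr
    refine ⟨_, _, hreg r₀, hreg r₁, fun x => hball ?_, ?_, hno⟩
    · have e : (fun l => r₀ * ψ x * a l) = (r₀ * ψ x) • a := rfl
      rw [e, Metric.mem_ball, dist_zero_right, norm_smul, Real.norm_eq_abs, abs_mul]
      have h2 : |r₀| * |ψ x| ≤ ε * 1 := by
        have : |ψ x| ≤ 1 := by
          rw [abs_of_nonneg ψ.nonneg]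
          exact ψ.le_one
        gcongr
      calc |r₀| * |ψ x| * ‖a‖ ≤ ε * 1 * ‖a‖ := by gcongr
        _ < ρ := by rwa [mul_one]
    · calc ∑ i, (sobolevNorm (s + 1) (fun x => r₀ * ψ x * a i) +
            sobolevNorm s (fun x => r₁ * ψ x * a i))
          ≤ ∑ i, (ENNReal.ofReal ε * (ENNReal.ofReal |a i| * sobolevNorm (s + 1) ψ) +
            ENNReal.ofReal ε * (ENNReal.ofReal |a i| * sobolevNorm s ψ)) :=
            Finset.sum_le_sum fun i _ => add_le_add (hsob _ _ h₀ i) (hsob _ _ h₁ i)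
        _ = ENNReal.ofReal ε * A := by simp only [hA, Finset.mul_sum, mul_add]
        _ = ENNReal.ofReal (ε * A.toReal) := by
            rw [ENNReal.ofReal_mul hε.le, ENNReal.ofReal_toReal hAtop.ne]
        _ ≤ ENNReal.ofReal δ := ENNReal.ofReal_le_ofReal hε1
  have hε0 : |(0 : ℝ)| ≤ ε := by simpa using hε.le
  have hεε : |ε| ≤ ε := (abs_of_pos hε).le
  rcases not_exists_isGlobalSolution hn hT hb_per hb2 hc hbc hbβ hunst h_line h_viol
    ψ.continuous (fun x => ψ.nonneg) (ψ.pos_of_mem_ball (Metric.mem_ball_self hR)) hR.le hκR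
    (fun x hx => ψ.zero_of_le_dist (by rwa [dist_zero_right])) with h | h
  · exact key 0 ε hε0 hεε (h ε hε)
  · exact key ε 0 hεε hε0 (h ε hε)
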